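/- Consider the unicycle $\dot x_1 = u_p\cos x_3$, $\dot x_2 = u_p \sin x_3$, $\dot x_3 = u_d$ on $\mathcal X = \mathbb R\times\mathbb R\times S^1$, with position $z=(x_1,x_2)$ and input $u=(u_p,u_d)$. For $i\in\mathcal N=\{1,\dots,N\}$ let $\gamma_i\in\{-1,1\}$, $\Delta_i\ge 0$, let $P_i\in\mathbb R^{2\times 2}$ be symmetric positive definite, $z_{r_i}\in\mathbb R^2$, $e_i=z-z_{r_i}$, let $a_i,b_i,k_{p_i},k_{d_i}>0$, and put $$h_i(x)=c_i(x)=\gamma_i\bigl(\Delta_i^2-\tfrac12 e_i^TP_ie_i\bigr),\quad \mathcal C^i=\{h_i\ge 0\},\quad \mathcal A^i=\{-b_i\le h_i\le a_i\}.$$ The safety controllers are $u_{s_i}=(u_{s_{p_i}},u_{s_{d_i}})$ with $$u_{s_{p_i}}=\begin{cases}-k_{p_i}\gamma_ic_i\,e_i^TP_i(\cos x_3,\sin x_3)^T,& c_i\ge 0,\\ k_{p_i}\gamma_ic_i\,e_i^TP_i(\cos x_3,\sin x_3)^T,& c_i<0,\end{cases}\qquad u_{s_{d_i}}=-k_{d_i}e_i^TP_i(-\sin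 x_3,\cos x_3)^T .$$ Let $\kappa_i:\mathbb R\to[0,1]$ be locally Lipschitz with $\kappa_i(0)=0$, $\kappa_i(a_i)=1$, and let $\phi_i(s)=1$ for $s>a_i$, $\phi_i(s)=\kappa_i(s)$ for $s\in[0,a_i]$, $\phi_i(s)=0$ for $s<0$. Assume $\mathcal A^i\cap\mathcal A^j=\emptyset$ for $i\ne j$. Let $\mathcal U\subseteq\mathbb R^2$ and let $u_{nom}:\mathcal X\to\mathcal U$ be locally Lipschitz. Consider the closed loop with $$u^*=(1-\bar\phi)\,\bar u_s+\bar\phi\,u_{nom},$$ where $\bar\phi(x)=\phi_i(h_i(x))$, $\bar u_s(x)=u_{s_i}(x)$ if $x\in\mathcal A^i$, and $\bar\phi(x)=1$, $\bar u_s(x)=0$ if $x$ lies in no $\mathcal A^i$. Solutions on $[0,T)$, $0<T\le\infty$, are understood in the sense of Carathéodory. Let $\mathcal R=\{x: h_i(x)>-b_i\ \forall i\in\mathcal N\}$. Then: (i) The closed loop is safe with respect to each $\mathcal C^i$: every solution with $x(0)\in\mathcal C^i$ satisfies $x(t)\in\mathcal C^i$ on its whole interval of existence. (In particular, if $x(0)\in\bigcap_i\mathcal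 C^i$ then $x(t)\in\bigcap_i\mathcal C^i$.) (ii) Suppose that no $\mathcal A^i$ contains a point with $z=z_{r_i}$, and that either a) $\gamma_i=1$ for some $i\in\mathcal N$, or b) from every initial state in $\mathcal R$ the trajectory is well defined for all $t\ge0$ (a maximal solution exists, and each one is global) and bounded. Then each $\mathcal C^i$, $i\in\mathcal N$, is asymptotically stable: for each $\varepsilon>0$ there is a $\delta>0$ such that solutions that start at distance less than $\delta$ from $\mathcal C^i$ remain at distance less than $\varepsilon$ from it, and there is a $\delta>0$ such that each maximal solution on $[0,T)$ that starts at distance less than $\delta$ from $\mathcal C^i$ satisfies $\operatorname{dist}(x(t),\mathcal C^i)\to0$ as $t\to T$ (thus as $t\to\infty$ if it is global). Moreover, in case a) the property in b) holds automatically. (iii) If $\mathcal U=\{u:|u_p|\le\bar u_p,\ |u_d|\le\bar u_d\}$ with $\bar u_p,\bar u_d>0$ and $$k_{p_i}\le\frac{\bar u_p}{\eta_i\max\{a_i,b_i\}},\qquad k_{d_i}\le\frac{\bar u_d}{\eta_i},\qquad \eta_i:=\max_{x\in\mathcal A^i}\|P_ie_i\|,\qquad\forall i\in\mathcal N,$$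 then $u^*(x)\in\mathcal U$ for all $x\in\bigcap_{i\in\mathcal N}(\mathcal A^i\cup\mathcal C^i)$. -/

import Mathlib

open scoped Matrix

noncomputable section

namespace Unicycle

/-- The state space `ℝ × ℝ × S¹`: the position `z = (x₁, x₂)` with its Euclidean norm, and the
heading angle `x₃`, an element of `ℝ / 2πℤ`. -/
abbrev State : Type := EuclideanSpace ℝ (Fin 2) × Real.Angle

/-- Inputs `u = (u_p, u_d)`: forward speed and rate of rotation. -/
abbrev Input : Type := ℝ × ℝ

/-! ### Trajectories -/

/-- The time interval `[0, T)`, with `0 < T ≤ ∞` in all uses. -/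
def timeDomain (T : EReal) : Set ℝ := {t | 0 ≤ t ∧ (t : EReal) < T}

/-- `x` is a (Carathéodory) solution on `[0, T)` of the closed-loop unicycle
`ẋ₁ = u_p cos x₃`, `ẋ₂ = u_p sin x₃`, `ẋ₃ = u_d` under the feedback `u`, that is, it satisfies
the integrated equations. The circle-valued equation for the heading is expressed through a real
lift `θ` of `x₃`. Wherever `u` is continuous this is the same as being a classical solution. -/
structure IsSolution (u : State → Input) (x : ℝ → State) (T : EReal) : Prop where
  pos : 0 < T
  integrable₁ : ∀ t ∈ timeDomain T, IntervalIntegrable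
    (fun s => (u (x s)).1 * (x s).2.cos) MeasureTheory.volume 0 t
  integrable₂ : ∀ t ∈ timeDomain T, IntervalIntegrable
    (fun s => (u (x s)).1 * (x s).2.sin) MeasureTheory.volume 0 t
  integrable₃ : ∀ t ∈ timeDomain T, IntervalIntegrable
    (fun s => (u (x s)).2) MeasureTheory.volume 0 t
  eq₁ : ∀ t ∈ timeDomain T,
    (x t).1 0 = (x 0).1 0 + ∫ s in (0 : ℝ)..t, (u (x s)).1 * (x s).2.cos
  eq₂ : ∀ t ∈ timeDomain T,
    (x t).1 1 = (x 0).1 1 + ∫ s in (0 : ℝ)..t, (u (x s)).1 * (x s).2.sin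
  eq₃ : ∃ θ : ℝ → ℝ, ∀ t ∈ timeDomain T,
    ((θ t : ℝ) : Real.Angle) = (x t).2 ∧ θ t = θ 0 + ∫ s in (0 : ℝ)..t, (u (x s)).2

/-- A solution on `[0, T)` that has no proper extension; `[0, T)` is then its maximal interval
of existence. -/
def IsMaximalSolution (u : State → Input) (x : ℝ → State) (T : EReal) : Prop :=
  IsSolution u x T ∧
    ∀ (y : ℝ → State) (T' : EReal), IsSolution u y T' → Set.EqOn x y (timeDomain T) → ¬ T < T'

/-- Safety of the closed loop with respect to `C`: a solution that starts in `C` stays in `C`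
for as long as it exists. -/
def IsSafe (u : State → Input) (C : Set State) : Prop :=
  ∀ (x : ℝ → State) (T : EReal), IsSolution u x T → x 0 ∈ C → ∀ t ∈ timeDomain T, x t ∈ C

/-- (Uniform) stability of the set `C`. -/
def IsStable (u : State → Input) (C : Set State) : Prop :=
  ∀ ε > 0, ∃ δ > 0, ∀ (x : ℝ → State) (T : EReal), IsSolution u x T →
    Metric.infDist (x 0) C < δ → ∀ t ∈ timeDomain T, Metric.infDist (x t) C < ε

/-- Attractivity of the set `C`: a maximal solution that starts close enough to `C` approaches
`C` at the end of its interval of existence. For solutions that are defined for all `t ≥ 0` this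
is convergence to `C` as `t → ∞`. -/
def IsAttractive (u : State → Input) (C : Set State) : Prop :=
  ∃ δ > 0, ∀ (x : ℝ → State) (T : EReal), IsMaximalSolution u x T →
    Metric.infDist (x 0) C < δ →
      ∀ ε > 0, ∃ t₀ ∈ timeDomain T, ∀ t ∈ timeDomain T, t₀ ≤ t → Metric.infDist (x t) C < ε

/-- Asymptotic stability of the set `C`. -/
def IsAsymptoticallyStable (u : State → Input) (C : Set State) : Prop :=
  IsStable u C ∧ IsAttractive u C

/-- From every initial state in `R` the trajectory `x(t)` is well defined for all `t ≥ 0`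
and bounded: a maximal solution exists, and each one is global and bounded. -/
def GlobalBoundedFrom (u : State → Input) (R : Set State) : Prop :=
  ∀ x₀ ∈ R, (∃ (x : ℝ → State) (T : EReal), IsMaximalSolution u x T ∧ x 0 = x₀) ∧
    ∀ (x : ℝ → State) (T : EReal), IsMaximalSolution u x T → x 0 = x₀ →
      T = ⊤ ∧ Bornology.IsBounded (x '' timeDomain T)

/-! ### Ellipsoidal barriers and their safety controllers -/

/-- The data of one ellipsoidal constraint with its annulus parameters, its gains and its
blending function (no conditions are imposed here). -/
structure Barrier where
  /-- `1`: stay inside the ellipse; `-1`: stay outside -/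
  γ : ℝ
  /-- the size of the ellipse -/
  Δ : ℝ
  /-- the shape matrix -/
  P : Matrix (Fin 2) (Fin 2) ℝ
  /-- the center `z_r` -/
  center : EuclideanSpace ℝ (Fin 2)
  /-- the annulus is `h ∈ [-b, a]` -/
  a : ℝ
  /-- the annulus is `h ∈ [-b, a]` -/
  b : ℝ
  /-- the gain of the speed -/
  kp : ℝ
  /-- the gain of the rotation -/
  kd : ℝ
  /-- the blending function on `[0, a]` -/
  κ : ℝ → ℝ

namespace Barrier

variable (B : Barrier)

/-- `P e` with `e = z - z_r`. -/
def Pe (x : State) : EuclideanSpace ℝ (Fin 2) :=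
  WithLp.toLp 2 (B.P *ᵥ (x.1 - B.center).ofLp)

/-- `h = c = γ (Δ² - ½ eᵀ P e)`. -/
def h (x : State) : ℝ :=
  B.γ * (B.Δ ^ 2 - 1 / 2 * ((x.1 - B.center).ofLp ⬝ᵥ (B.P *ᵥ (x.1 - B.center).ofLp)))

/-- The safe set `C = {h ≥ 0}`. -/
def safeSet : Set State := {x | 0 ≤ B.h x}

/-- The annulus `A = {h ∈ [-b, a]}`. -/
def annulus : Set State := {x | B.h x ∈ Set.Icc (-B.b) B.a}

/-- The safety controller `u_s = (u_{s_p}, u_{s_d})`. As `P` is symmetric, `eᵀ P v = (P e)ᵀ v`. -/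
def safetyControl (x : State) : Input :=
  (if 0 ≤ B.h x then
      -B.kp * B.γ * B.h x * (B.Pe x 0 * x.2.cos + B.Pe x 1 * x.2.sin)
    else
      B.kp * B.γ * B.h x * (B.Pe x 0 * x.2.cos + B.Pe x 1 * x.2.sin),
   -B.kd * (B.Pe x 0 * (-x.2.sin) + B.Pe x 1 * x.2.cos))

/-- The switching function `φ_a`. -/
def φ (s : ℝ) : ℝ := if B.a < s then 1 else if 0 ≤ s then B.κ s else 0

/-- `η = max_{x ∈ A} ‖P e‖` (Euclidean norm). -/
def η : ℝ := sSup ((fun x => ‖B.Pe x‖) '' B.annulus)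

/-- The standing conditions on the parameters of a barrier. -/
structure Admissible : Prop where
  γ_eq : B.γ = 1 ∨ B.γ = -1
  Δ_nonneg : 0 ≤ B.Δ
  P_posDef : B.P.PosDef
  a_pos : 0 < B.a
  b_pos : 0 < B.b
  kp_pos : 0 < B.kp
  kd_pos : 0 < B.kd
  κ_lipschitz : LocallyLipschitz B.κ
  κ_mem : ∀ s, B.κ s ∈ Set.Icc (0 : ℝ) 1
  κ_zero : B.κ 0 = 0
  κ_a : B.κ B.a = 1

end Barrier

/-! ### The mixed-initiative controller for several barriers -/

variable {N : ℕ} (B : Fin N → Barrier)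

open Classical in
/-- `φ̄(x) = φ_{a_i}(h_i(x))` if `x ∈ A^i`, and `1` if `x` is in no annulus (the index is unique
when the annuli are disjoint). -/
def φBar (x : State) : ℝ :=
  if hx : ∃ i, x ∈ (B i).annulus then (B hx.choose).φ ((B hx.choose).h x) else 1

open Classical in
/-- `ū_s(x) = u_{s_i}(x)` if `x ∈ A^i`, and `0` if `x` is in no annulus. -/
def uBar (x : State) : Input :=
  if hx : ∃ i, x ∈ (B i).annulus then (B hx.choose).safetyControl x else 0

/-- `u* = (1 - φ̄) ū_s + φ̄ u_nom`. -/
def mixedControl (unom : State → Input) (x : State) : Input :=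
  (1 - φBar B x) • uBar B x + φBar B x • unom x

/-- The input box `{|u_p| ≤ ū_p, |u_d| ≤ ū_d}`. -/
def inputBox (up ud : ℝ) : Set Input := {u | |u.1| ≤ up ∧ |u.2| ≤ ud}

/-- The states that satisfy `h_i > -b_i` for every `i`. -/
def operatingRegion : Set State := {x | ∀ i, -(B i).b < (B i).h x}

end Unicycle

end

/-!
Write `w` and `q` for the components of `P e` along and across the heading. Where `-b_i ≤ h_i ≤ 0`
the blending function vanishes, so the closed loop is driven by the safety controller alone, and
`ḣ_i = -k_p h_i w² ≥ 0`. Hence a solution with `h_i > -b_i` satisfies `h_i ≥ min (h_i(t₀)) 0` from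
`t₀` on (`min_h_zero_le`). This one-sided monotonicity gives safety, the forward invariance of the
operating region, and stability, since near the safe set smallness of `-h_i` and smallness of the
distance amount to the same thing by compactness. The feedback jumps only at `h_i = -b_i`; wherever
it agrees with a continuous feedback, a Carathéodory solution has a right derivative
(`IsSolution.exists_lift`), which is what the monotonicity argument needs.

Existence, uniqueness and continuation of solutions come from a single fact (`exists_flow`). On
a compact set the velocity given by a locally Lipschitz feedback extends to a bounded, globally
Lipschitz field, whose flow, computed on the cover `ℝ² × ℝ` of the state space, is global. The
mixed control agrees on the operating region with a locally Lipschitz feedback (`smoothedControl`).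
If some `γ_i = 1`, solutions cannot leave a compact part of the operating region
(`globalBoundedFrom_operatingRegion`).

For attractivity, suppose that `-b_i < h_i ≤ -η` for the whole life of a maximal solution. It stays
in a compact set, so its life is infinite. There `ẇ ≤ L |w| - k_d q²` while `w² + q² = ‖P e‖²` is
bounded below, as the annulus avoids the center, and `ḣ_i ≥ k_p η w²`. For suitable constants
`w + α t - C h_i` is therefore nonincreasing, which contradicts the boundedness of `w` and `h_i`
(`Barrier.Admissible.not_forall_h_mem_Icc`). This argument takes place in a single annulus and does
not involve the global behaviour of the closed loop. The input constraints follow from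
`|w|, |q| ≤ ‖P e‖ ≤ η_i` and the convexity of the input box.
-/

/-! ### The circle of headings, and locally Lipschitz functions -/

section Analysis

open Set Filter Metric
open scoped Topology NNReal

namespace Real.Angle

lemma dist_coe_le (s t : ℝ) : dist (s : Real.Angle) t ≤ |s - t| := by
  rw [dist_eq_norm, ← Real.Angle.coe_sub]
  exact QuotientAddGroup.norm_mk_le_norm

lemma exists_coe_sub_le (α β : Real.Angle) :
    ∃ s t : ℝ, (s : Real.Angle) = α ∧ (t : Real.Angle) = β ∧ |s - t| = dist α β := by
  obtain ⟨t, rfl⟩ : ∃ t : ℝ, (t : Real.Angle) = β := ⟨β.toReal, β.coe_toReal⟩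
  refine ⟨(α - t).toReal + t, t, by simp, rfl, ?_⟩
  have hp : (2 * Real.pi) ≠ 0 := by positivity
  have h1 : ‖(((α - t).toReal : ℝ) : AddCircle (2 * Real.pi))‖ = |(α - t).toReal| := by
    rw [AddCircle.norm_coe_eq_abs_iff _ hp, abs_of_pos (by positivity : (0:ℝ) < 2 * Real.pi)]
    have := Real.Angle.abs_toReal_le_pi (α - t)
    linarith
  rw [add_sub_cancel_right, ← h1, dist_eq_norm]
  exact congrArg (fun a : Real.Angle => ‖a‖) (Real.Angle.coe_toReal (α - t))

lemma lipschitzWith_cos : LipschitzWith 1 Real.Angle.cos := by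
  refine LipschitzWith.of_dist_le_mul fun α β => ?_
  obtain ⟨s, t, rfl, rfl, h⟩ := exists_coe_sub_le α β
  rw [NNReal.coe_one, one_mul, ← h, Real.Angle.cos_coe, Real.Angle.cos_coe, Real.dist_eq]
  exact Real.abs_cos_sub_cos_le s t

lemma lipschitzWith_sin : LipschitzWith 1 Real.Angle.sin := by
  refine LipschitzWith.of_dist_le_mul fun α β => ?_
  obtain ⟨s, t, rfl, rfl, h⟩ := exists_coe_sub_le α β
  rw [NNReal.coe_one, one_mul, ← h, Real.Angle.sin_coe, Real.Angle.sin_coe, Real.dist_eq]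
  exact Real.abs_sin_sub_sin_le s t

lemma isCompact_univ : IsCompact (univ : Set Real.Angle) := by
  have h : ((↑) : ℝ → Real.Angle) '' Icc (-Real.pi) Real.pi = univ := by
    refine eq_univ_of_forall fun α => ⟨α.toReal, ⟨?_, α.toReal_le_pi⟩, α.coe_toReal⟩
    exact α.neg_pi_lt_toReal.le
  rw [← h]
  exact isCompact_Icc.image Real.Angle.continuous_coe

end Real.Angle

lemma LocallyLipschitz.mul_real {X : Type*} [PseudoMetricSpace X] {f g : X → ℝ}
    (hf : LocallyLipschitz f) (hg : LocallyLipschitz g) : LocallyLipschitz fun x => f x * g x := by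
  have h : LocallyLipschitz fun p : ℝ × ℝ => p.1 * p.2 :=
    ContDiff.locallyLipschitz (𝕂 := ℝ) (by fun_prop)
  exact h.comp (hf.prodMk hg)

lemma LocallyLipschitz.finset_sum {X E ι : Type*} [PseudoMetricSpace X] [SeminormedAddCommGroup E]
    (s : Finset ι) {f : ι → X → E} (hf : ∀ i, LocallyLipschitz (f i)) :
    LocallyLipschitz fun x => ∑ i ∈ s, f i x := by
  classical
  induction s using Finset.induction_on with
  | empty => simpa using LocallyLipschitz.const (0 : E)
  | insert i s hi ih =>
    simp only [Finset.sum_insert hi]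
    exact (hf i).add ih

lemma LocallyLipschitz.exists_bounded_lipschitz_eqOn {X : Type*} [PseudoMetricSpace X] {f : X → ℝ}
    (hf : LocallyLipschitz f) {K : Set X} (hK : IsCompact K) :
    ∃ (g : X → ℝ) (C : ℝ≥0) (M : ℝ), LipschitzWith C g ∧ (∀ x, |g x| ≤ M) ∧ EqOn f g K := by
  obtain ⟨C, hC⟩ := LocallyLipschitzOn.exists_lipschitzOnWith_of_compact hK
    hf.locallyLipschitzOn
  obtain ⟨g, hg, hfg⟩ := hC.extend_real
  obtain ⟨M, hM⟩ := hK.exists_bound_of_continuousOn hf.continuous.continuousOn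
  have hM' : ∀ x ∈ K, |f x| ≤ |M| := fun x hx => (hM x hx).trans (le_abs_self M)
  refine ⟨fun x => max (-|M|) (min |M| (g x)), C, |M|, (hg.const_min _).const_max _, fun x => ?_,
    fun x hx => ?_⟩
  · have := abs_nonneg M
    rw [abs_le]
    exact ⟨le_max_left _ _, max_le (by linarith) (min_le_left _ _)⟩
  · have h := abs_le.1 (hM' x hx)
    show f x = max (-|M|) (min |M| (g x))
    rw [← hfg hx, min_eq_right h.2, max_eq_right h.1]

/-! ### Global solutions of Lipschitz differential equations -/

/-- On the time interval `[-n, n]` the Picard-Lindelöf theorem applies to the ball of radius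
`M n`, where `M` bounds the field; the solutions for different `n` agree by uniqueness. -/
lemma exists_forall_hasDerivAt_of_lipschitz_of_bounded {V : Type*} [NormedAddCommGroup V]
    [NormedSpace ℝ V] [CompleteSpace V] {F : V → V} {C : ℝ≥0} {M : ℝ} (hF : LipschitzWith C F)
    (hM : ∀ x, ‖F x‖ ≤ M) (x₀ : V) :
    ∃ y : ℝ → V, y 0 = x₀ ∧ ∀ t, HasDerivAt y (F (y t)) t := by
  have hM0 : 0 ≤ M := (norm_nonneg _).trans (hM x₀)
  have key : ∀ n : ℕ, ∃ α : ℝ → V, α 0 = x₀ ∧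
      ∀ t ∈ Ioo (-((n : ℝ) + 1)) (n + 1), HasDerivAt α (F (α t)) t := by
    intro n
    have h0 : (0 : ℝ) ∈ Icc (-((n : ℝ) + 1)) (n + 1) := ⟨by linarith [n.cast_nonneg (α := ℝ)],
      by positivity⟩
    have hpl : IsPicardLindelof (fun _ : ℝ => F) (⟨0, h0⟩ : Icc (-((n : ℝ) + 1)) (n + 1)) x₀
        (M.toNNReal * (n + 1)) 0 M.toNNReal C :=
      { lipschitzOnWith := fun t _ => hF.lipschitzOnWith
        continuousOn := fun x _ => continuousOn_const
        norm_le := fun t _ x _ => by rw [Real.coe_toNNReal _ hM0]; exact hM x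
        mul_max_le := by simp }
    obtain ⟨α, hα, hα'⟩ := hpl.exists_eq_forall_mem_Icc_hasDerivWithinAt₀
    exact ⟨α, hα, fun t ht => (hα' t (Ioo_subset_Icc_self ht)).hasDerivAt
      (Icc_mem_nhds ht.1 ht.2)⟩
  choose α hα hα' using key
  have agree : ∀ n m : ℕ, n ≤ m → ∀ t : ℝ, |t| < n + 1 → α n t = α m t := by
    intro n m hnm t ht
    have hnm' : (n : ℝ) ≤ m := by exact_mod_cast hnm
    have hn : (0 : ℝ) ≤ n := n.cast_nonneg
    refine ODE_solution_unique_of_mem_Ioo (v := fun _ => F) (s := fun _ => univ)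
      (t₀ := 0) (K := C) (fun _ _ => hF.lipschitzOnWith)
      ⟨by linarith, by linarith⟩ (fun s hs => ⟨hα' n s hs, mem_univ _⟩)
      (fun s hs => ⟨hα' m s ⟨by linarith [hs.1], by linarith [hs.2]⟩, mem_univ _⟩)
      ((hα n).trans (hα m).symm) (abs_lt.1 ht)
  refine ⟨fun t => α ⌈|t|⌉₊ t, hα _, fun t => ?_⟩
  set m : ℕ := ⌈|t|⌉₊ + 1
  have htm : |t| < m := by
    have := Nat.le_ceil |t|
    push_cast [m]
    linarith
  have hev : ∀ s : ℝ, |s| < m → α ⌈|s|⌉₊ s = α m s := fun s hs =>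
    agree _ _ (Nat.ceil_le.2 hs.le) s (by linarith [Nat.le_ceil |s|])
  have hd : HasDerivAt (α m) (F (α m t)) t :=
    hα' m t ⟨by linarith [(abs_lt.1 htm).1], by linarith [(abs_lt.1 htm).2]⟩
  show HasDerivAt (fun t => α ⌈|t|⌉₊ t) (F (α ⌈|t|⌉₊ t)) t
  rw [hev t htm]
  refine hd.congr_of_eventuallyEq ?_
  filter_upwards [(isOpen_lt continuous_abs continuous_const).mem_nhds htm] with s hs
  exact hev s hs

end Analysis

/-! ### Real lifts of solutions -/

section Solutions

open Set Filter Metric MeasureTheory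
open scoped Topology NNReal

namespace Unicycle

/-- The covering map that reduces a real heading modulo `2π`. -/
noncomputable def lift (p : EuclideanSpace ℝ (Fin 2) × ℝ) : State := (p.1, (p.2 : Real.Angle))

/-- The velocity of the unicycle at `x` under the feedback `u`, with the heading lifted to `ℝ`. -/
noncomputable def field (u : State → Input) (x : State) : EuclideanSpace ℝ (Fin 2) × ℝ :=
  (!₂[(u x).1 * x.2.cos, (u x).1 * x.2.sin], (u x).2)

lemma lipschitzWith_lift : LipschitzWith 1 lift := by
  refine LipschitzWith.of_dist_le_mul fun p q => ?_
  rw [NNReal.coe_one, one_mul, Prod.dist_eq, Prod.dist_eq]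
  exact max_le_max le_rfl (Real.Angle.dist_coe_le _ _)

lemma continuous_lift : Continuous lift := lipschitzWith_lift.continuous

lemma timeDomain_of_le {T : EReal} {s t : ℝ} (ht : t ∈ timeDomain T) (h0 : 0 ≤ s) (hst : s ≤ t) :
    s ∈ timeDomain T :=
  ⟨h0, (EReal.coe_le_coe_iff.2 hst).trans_lt ht.2⟩

lemma Icc_subset_timeDomain {T : EReal} {s t : ℝ} (hs : s ∈ timeDomain T) (ht : t ∈ timeDomain T) :
    Icc s t ⊆ timeDomain T :=
  fun _ hr => timeDomain_of_le ht (hs.1.trans hr.1) hr.2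

lemma zero_mem_timeDomain {T : EReal} (hT : 0 < T) : (0 : ℝ) ∈ timeDomain T := ⟨le_rfl, hT⟩

lemma exists_gt_mem_timeDomain {T : EReal} {t : ℝ} (ht : t ∈ timeDomain T) :
    ∃ r, t < r ∧ r ∈ timeDomain T := by
  obtain ⟨r, h1, h2⟩ := EReal.lt_iff_exists_real_btwn.1 ht.2
  exact ⟨r, EReal.coe_lt_coe_iff.1 h1, ht.1.trans (EReal.coe_lt_coe_iff.1 h1).le, h2⟩

lemma mem_timeDomain_coe {τ t : ℝ} : t ∈ timeDomain (τ : EReal) ↔ 0 ≤ t ∧ t < τ := by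
  simp [timeDomain]

lemma timeDomain_top : timeDomain ⊤ = Ici 0 := by
  ext t
  simp [timeDomain, EReal.coe_lt_top]

lemma continuousOn_of_eq_integral {T : EReal} {f F : ℝ → ℝ}
    (hint : ∀ t ∈ timeDomain T, IntervalIntegrable f volume 0 t)
    (hF : ∀ t ∈ timeDomain T, F t = F 0 + ∫ s in (0 : ℝ)..t, f s) :
    ContinuousOn F (timeDomain T) := by
  intro t ht
  obtain ⟨r, htr, hr⟩ := exists_gt_mem_timeDomain ht
  have hc := intervalIntegral.continuousOn_primitive_interval' (hint r hr) left_mem_uIcc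
  rw [uIcc_of_le hr.1] at hc
  have hc' : ContinuousOn F (Icc 0 r) :=
    (hc.const_add (F 0)).congr fun s hs => hF s (timeDomain_of_le hr hs.1 hs.2)
  refine (hc' t ⟨ht.1, htr.le⟩).mono_of_mem_nhdsWithin ?_
  filter_upwards [self_mem_nhdsWithin, mem_nhdsWithin_of_mem_nhds (Iio_mem_nhds htr)] with s h1 h2
  exact ⟨h1.1, h2.le⟩

lemma hasDerivWithinAt_of_eq_integral {T : EReal} {f F g : ℝ → ℝ} {t : ℝ}
    (hint : ∀ t ∈ timeDomain T, IntervalIntegrable f volume 0 t)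
    (hF : ∀ t ∈ timeDomain T, F t = F 0 + ∫ s in (0 : ℝ)..t, f s) (ht : t ∈ timeDomain T)
    (hg : ContinuousWithinAt g (Ici t) t) (hfg : f =ᶠ[𝓝[≥] t] g) :
    HasDerivWithinAt F (g t) (Ici t) t := by
  obtain ⟨r, htr, hr⟩ := exists_gt_mem_timeDomain ht
  have hft : f t = g t := hfg.self_of_nhdsWithin self_mem_Ici
  have hmeas : StronglyMeasurableAtFilter f (𝓝[Ioi t] t) := by
    refine ⟨Ioc t r, Ioc_mem_nhdsGT htr, ?_⟩
    have h := (intervalIntegrable_iff_integrableOn_Ioc_of_le hr.1).1 (hint r hr)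
    exact (h.mono_set (Ioc_subset_Ioc_left ht.1)).aestronglyMeasurable
  have hfc : ContinuousWithinAt f (Ioi t) t :=
    (hg.congr_of_eventuallyEq hfg hft).mono Ioi_subset_Ici_self
  have hd := intervalIntegral.integral_hasDerivWithinAt_right (s := Ici t) (t := Ioi t)
    (hint t ht) hmeas hfc
  rw [← hft]
  refine (hd.const_add (F 0)).congr_of_eventuallyEq ?_ (hF t ht)
  filter_upwards [self_mem_nhdsWithin, mem_nhdsWithin_of_mem_nhds (Iio_mem_nhds htr)] with s h1 h2
  exact hF s (timeDomain_of_le hr (ht.1.trans h1) h2.le)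

lemma hasDerivWithinAt_euclideanTwo {z : ℝ → EuclideanSpace ℝ (Fin 2)} {a b : ℝ} {s : Set ℝ}
    {t : ℝ} (h0 : HasDerivWithinAt (fun r => z r 0) a s t)
    (h1 : HasDerivWithinAt (fun r => z r 1) b s t) : HasDerivWithinAt z !₂[a, b] s t := by
  refine hasFDerivWithinAt_euclidean.2 fun i => ?_
  fin_cases i
  · refine h0.hasFDerivWithinAt.congr_fderiv ?_
    ext; simp
  · refine h1.hasFDerivWithinAt.congr_fderiv ?_
    ext; simp

lemma hasDerivWithinAt_euclidean_apply {z : ℝ → EuclideanSpace ℝ (Fin 2)}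
    {v : EuclideanSpace ℝ (Fin 2)} {s : Set ℝ} {t : ℝ} (h : HasDerivWithinAt z v s t) (i : Fin 2) :
    HasDerivWithinAt (fun r => z r i) (v i) s t :=
  ((EuclideanSpace.proj (𝕜 := ℝ) i).hasFDerivAt.comp_hasDerivWithinAt t h :)

/-- Solutions are only absolutely continuous, but a solution has a right derivative wherever the
feedback agrees with a continuous one along the solution immediately afterwards. -/
lemma IsSolution.exists_lift {u : State → Input} {x : ℝ → State} {T : EReal}
    (hx : IsSolution u x T) {θ₀ : ℝ} (hθ₀ : (θ₀ : Real.Angle) = (x 0).2) :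
    ∃ Z : ℝ → EuclideanSpace ℝ (Fin 2) × ℝ, Z 0 = ((x 0).1, θ₀) ∧
      (∀ t ∈ timeDomain T, lift (Z t) = x t) ∧ ContinuousOn Z (timeDomain T) ∧
      ∀ t ∈ timeDomain T, ∀ G : State → Input, Continuous G →
        (∀ᶠ s in 𝓝[≥] t, u (x s) = G (x s)) →
        HasDerivWithinAt Z (field G (x t)) (Ici t) t := by
  obtain ⟨θ, hθ⟩ := hx.eq₃
  have h0 := zero_mem_timeDomain hx.pos
  set Z : ℝ → EuclideanSpace ℝ (Fin 2) × ℝ := fun t => ((x t).1, θ t - θ 0 + θ₀)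
  have hlift : ∀ t ∈ timeDomain T, lift (Z t) = x t := fun t ht => by
    refine Prod.ext rfl ?_
    simp only [lift, Z, Real.Angle.coe_add, Real.Angle.coe_sub, (hθ t ht).1, (hθ 0 h0).1, hθ₀]
    abel
  have hc : ContinuousOn Z (timeDomain T) := by
    refine ContinuousOn.prodMk ?_ ?_
    · have c0 := continuousOn_of_eq_integral (F := fun t => (x t).1 0) hx.integrable₁ hx.eq₁
      have c1 := continuousOn_of_eq_integral (F := fun t => (x t).1 1) hx.integrable₂ hx.eq₂
      have : ContinuousOn (fun t => (x t).1.ofLp) (timeDomain T) := by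
        refine continuousOn_pi.2 fun i => ?_
        fin_cases i
        · exact c0
        · exact c1
      exact (PiLp.continuous_toLp 2 _).comp_continuousOn this
    · exact ((continuousOn_of_eq_integral hx.integrable₃ fun t ht => (hθ t ht).2).sub
        continuousOn_const).add continuousOn_const
  have hxc : ContinuousOn x (timeDomain T) :=
    (continuous_lift.comp_continuousOn hc).congr fun t ht => (hlift t ht).symm
  refine ⟨Z, by simp [Z], hlift, hc, fun t ht G hG huG => ?_⟩
  have hxt : ContinuousWithinAt x (Ici t) t := by
    obtain ⟨r, htr, hr⟩ := exists_gt_mem_timeDomain ht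
    refine (hxc t ht).mono_of_mem_nhdsWithin ?_
    filter_upwards [self_mem_nhdsWithin, mem_nhdsWithin_of_mem_nhds (Iio_mem_nhds htr)]
      with s h1 h2
    exact timeDomain_of_le hr (ht.1.trans h1) h2.le
  have hGx : ContinuousWithinAt (fun s => G (x s)) (Ici t) t :=
    hG.continuousAt.comp_continuousWithinAt hxt
  have hcos : ContinuousWithinAt (fun s => (x s).2.cos) (Ici t) t :=
    Real.Angle.continuous_cos.continuousAt.comp_continuousWithinAt hxt.snd
  have hsin : ContinuousWithinAt (fun s => (x s).2.sin) (Ici t) t :=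
    Real.Angle.continuous_sin.continuousAt.comp_continuousWithinAt hxt.snd
  have d0 := hasDerivWithinAt_of_eq_integral (F := fun t => (x t).1 0)
    (g := fun s => (G (x s)).1 * (x s).2.cos) hx.integrable₁ hx.eq₁ ht (hGx.fst.mul hcos)
    (huG.mono fun s hs => by simp only [hs])
  have d1 := hasDerivWithinAt_of_eq_integral (F := fun t => (x t).1 1)
    (g := fun s => (G (x s)).1 * (x s).2.sin) hx.integrable₂ hx.eq₂ ht (hGx.fst.mul hsin)
    (huG.mono fun s hs => by simp only [hs])
  have d2 := hasDerivWithinAt_of_eq_integral (F := θ)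
    (g := fun s => (G (x s)).2) hx.integrable₃ (fun t ht => (hθ t ht).2) ht hGx.snd
    (huG.mono fun s hs => by simp only [hs])
  exact (hasDerivWithinAt_euclideanTwo d0 d1).prodMk ((d2.sub_const _).add_const _)

lemma IsSolution.continuousOn {u : State → Input} {x : ℝ → State} {T : EReal}
    (hx : IsSolution u x T) : ContinuousOn x (timeDomain T) := by
  obtain ⟨Z, -, hZ, hc, -⟩ := hx.exists_lift (x 0).2.coe_toReal
  exact (continuous_lift.comp_continuousOn hc).congr fun t ht => (hZ t ht).symm

lemma IsSolution.congr {u w : State → Input} {x : ℝ → State} {T : EReal}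
    (hx : IsSolution u x T) (huw : ∀ t ∈ timeDomain T, u (x t) = w (x t)) : IsSolution w x T := by
  have hI : ∀ (φ : Input → State → ℝ), ∀ t ∈ timeDomain T,
      EqOn (fun s => φ (u (x s)) (x s)) (fun s => φ (w (x s)) (x s)) (uIcc 0 t) := by
    intro φ t ht s hs
    rw [uIcc_of_le ht.1] at hs
    simp only [huw s (timeDomain_of_le ht hs.1 hs.2)]
  have hint : ∀ (φ : Input → State → ℝ), ∀ t ∈ timeDomain T,
      IntervalIntegrable (fun s => φ (u (x s)) (x s)) volume 0 t →
      IntervalIntegrable (fun s => φ (w (x s)) (x s)) volume 0 t := fun φ t ht h =>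
    h.congr fun s hs => hI φ t ht (uIoc_subset_uIcc hs)
  have heq : ∀ (φ : Input → State → ℝ), ∀ t ∈ timeDomain T,
      ∫ s in (0 : ℝ)..t, φ (u (x s)) (x s) = ∫ s in (0 : ℝ)..t, φ (w (x s)) (x s) :=
    fun φ t ht => intervalIntegral.integral_congr (hI φ t ht)
  obtain ⟨θ, hθ⟩ := hx.eq₃
  refine ⟨hx.pos,
    fun t ht => hint (fun v y => v.1 * y.2.cos) t ht (hx.integrable₁ t ht),
    fun t ht => hint (fun v y => v.1 * y.2.sin) t ht (hx.integrable₂ t ht),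
    fun t ht => hint (fun v _ => v.2) t ht (hx.integrable₃ t ht),
    fun t ht => ?_, fun t ht => ?_, θ, fun t ht => ⟨(hθ t ht).1, ?_⟩⟩
  · rw [hx.eq₁ t ht, heq (fun v y => v.1 * y.2.cos) t ht]
  · rw [hx.eq₂ t ht, heq (fun v y => v.1 * y.2.sin) t ht]
  · rw [(hθ t ht).2, heq (fun v _ => v.2) t ht]

lemma isSolution_lift {G : State → Input} {Y : ℝ → EuclideanSpace ℝ (Fin 2) × ℝ}
    {W : State → EuclideanSpace ℝ (Fin 2) × ℝ} {T : EReal} (hT : 0 < T) (hW : Continuous W)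
    (hY : ∀ t, HasDerivAt Y (W (lift (Y t))) t)
    (hWG : ∀ t ∈ timeDomain T, W (lift (Y t)) = field G (lift (Y t))) :
    IsSolution G (fun t => lift (Y t)) T := by
  have hYc : Continuous Y := continuous_iff_continuousAt.2 fun t => (hY t).continuousAt
  have hWc : Continuous fun t => W (lift (Y t)) := hW.comp (continuous_lift.comp hYc)
  have key : ∀ (F f g : ℝ → ℝ), Continuous f → (∀ t, HasDerivAt F (f t) t) →
      (∀ t ∈ timeDomain T, f t = g t) → ∀ t ∈ timeDomain T,
      IntervalIntegrable g volume 0 t ∧ F t = F 0 + ∫ s in (0 : ℝ)..t, g s := by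
    intro F f g hf hF hfg t ht
    have hE : EqOn f g (uIcc 0 t) := by
      intro s hs
      rw [uIcc_of_le ht.1] at hs
      exact hfg s (timeDomain_of_le ht hs.1 hs.2)
    refine ⟨(hf.intervalIntegrable 0 t).congr fun s hs => hE (uIoc_subset_uIcc hs), ?_⟩
    rw [← intervalIntegral.integral_congr hE, intervalIntegral.integral_eq_sub_of_hasDerivAt
      (fun s _ => hF s) (hf.intervalIntegrable 0 t)]
    ring
  have hd : ∀ i t, HasDerivAt (fun r => (Y r).1 i) ((W (lift (Y t))).1 i) t := fun i t =>
    hasDerivWithinAt_univ.1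
      (hasDerivWithinAt_euclidean_apply (hasDerivWithinAt_univ.2 (hY t).fst) i)
  have hci : ∀ i : Fin 2, Continuous fun t => (W (lift (Y t))).1 i := fun i =>
    (EuclideanSpace.proj (𝕜 := ℝ) i).continuous.comp hWc.fst
  have k0 := key _ _ (fun s => (G (lift (Y s))).1 * (lift (Y s)).2.cos) (hci 0) (hd 0)
    fun t ht => by rw [hWG t ht]; simp [field]
  have k1 := key _ _ (fun s => (G (lift (Y s))).1 * (lift (Y s)).2.sin) (hci 1) (hd 1)
    fun t ht => by rw [hWG t ht]; simp [field]
  have k2 := key _ _ (fun s => (G (lift (Y s))).2) hWc.snd (fun t => (hY t).snd)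
    fun t ht => by rw [hWG t ht]; simp [field]
  exact ⟨hT, fun t ht => (k0 t ht).1, fun t ht => (k1 t ht).1, fun t ht => (k2 t ht).1,
    fun t ht => (k0 t ht).2, fun t ht => (k1 t ht).2,
    fun t => (Y t).2, fun t ht => ⟨rfl, (k2 t ht).2⟩⟩

/-- The velocity field is replaced off the compact set `K` by a bounded Lipschitz one. The curve
`y` follows the new field for all time, so it is a solution of the original equation, and the only
one, as long as it stays in `K`. -/
lemma exists_flow {G : State → Input} (hG : LocallyLipschitz G) {K : Set State} (hK : IsCompact K)
    (x₀ : State) :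
    ∃ y : ℝ → State, Continuous y ∧ y 0 = x₀ ∧
      (∀ T : EReal, 0 < T → (∀ t ∈ timeDomain T, y t ∈ K) → IsSolution G y T) ∧
      ∀ (x : ℝ → State) (T : EReal), IsSolution G x T → x 0 = x₀ →
        (∀ t ∈ timeDomain T, x t ∈ K) → EqOn x y (timeDomain T) := by
  have hsnd : LocallyLipschitz fun x : State => x.2 := LipschitzWith.prod_snd.locallyLipschitz
  have hcos : LocallyLipschitz fun x : State => x.2.cos :=
    Real.Angle.lipschitzWith_cos.locallyLipschitz.comp hsnd
  have hsin : LocallyLipschitz fun x : State => x.2.sin :=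
    Real.Angle.lipschitzWith_sin.locallyLipschitz.comp hsnd
  have hG1 : LocallyLipschitz fun x => (G x).1 := LipschitzWith.prod_fst.locallyLipschitz.comp hG
  have hG2 : LocallyLipschitz fun x => (G x).2 := LipschitzWith.prod_snd.locallyLipschitz.comp hG
  obtain ⟨g0, C0, M0, hg0, hM0, he0⟩ := (hG1.mul_real hcos).exists_bounded_lipschitz_eqOn hK
  obtain ⟨g1, C1, M1, hg1, hM1, he1⟩ := (hG1.mul_real hsin).exists_bounded_lipschitz_eqOn hK
  obtain ⟨g2, C2, M2, hg2, hM2, he2⟩ := hG2.exists_bounded_lipschitz_eqOn hK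
  set W : State → EuclideanSpace ℝ (Fin 2) × ℝ := fun x => (!₂[g0 x, g1 x], g2 x)
  have hWK : ∀ x ∈ K, W x = field G x := fun x hx => by
    simp only [W, field, ← he0 hx, ← he1 hx, ← he2 hx]
  have hpi : LipschitzWith (max C0 C1) fun x => ![g0 x, g1 x] := by
    refine LipschitzWith.of_dist_le_mul fun x y => ?_
    refine (dist_pi_le_iff (by positivity)).2 fun i => ?_
    fin_cases i
    · exact (hg0.weaken (le_max_left _ _)).dist_le_mul x y
    · exact (hg1.weaken (le_max_right _ _)).dist_le_mul x y
  have hW := ((PiLp.lipschitzWith_toLp 2 fun _ : Fin 2 => ℝ).comp hpi).prodMk hg2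
  have hWM : ∀ x, ‖W x‖ ≤ max (M0 + M1) M2 := fun x => by
    refine max_le_max ?_ (hM2 x)
    rw [EuclideanSpace.norm_eq, Fin.sum_univ_two]
    refine (Real.sqrt_le_sqrt (y := (M0 + M1) ^ 2) ?_).trans ?_
    · have h0 := hM0 x
      have h1 := hM1 x
      have a0 := abs_nonneg (g0 x)
      have a1 := abs_nonneg (g1 x)
      show |g0 x| ^ 2 + |g1 x| ^ 2 ≤ (M0 + M1) ^ 2
      nlinarith
    · rw [Real.sqrt_sq (by linarith [hM0 x, hM1 x, abs_nonneg (g0 x), abs_nonneg (g1 x)])]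
  have hF := hW.comp lipschitzWith_lift
  have hx₀ : ((x₀.2.toReal : ℝ) : Real.Angle) = x₀.2 := x₀.2.coe_toReal
  obtain ⟨Y, hY0, hY⟩ := exists_forall_hasDerivAt_of_lipschitz_of_bounded hF
    (fun p => hWM (lift p)) (x₀.1, x₀.2.toReal)
  have hYc : Continuous Y := continuous_iff_continuousAt.2 fun t => (hY t).continuousAt
  refine ⟨fun t => lift (Y t), continuous_lift.comp hYc, ?_, fun T hT hTK => ?_,
    fun x T hx hx0 hxK t ht => ?_⟩
  · show lift (Y 0) = x₀
    rw [hY0]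
    exact Prod.ext rfl hx₀
  · exact isSolution_lift hT hW.continuous hY fun t ht => hWK _ (hTK t ht)
  · obtain ⟨Z, hZ0, hZx, hZc, hZd⟩ := hx.exists_lift (θ₀ := x₀.2.toReal) (hx0 ▸ hx₀)
    have hsub := Icc_subset_timeDomain (zero_mem_timeDomain hx.pos) ht
    have := ODE_solution_unique (v := fun _ p => W (lift p)) (a := 0) (b := t) (f := Z) (g := Y)
      (fun _ => hF) (hZc.mono hsub)
      (fun s hs => by
        have hs' := hsub (Ico_subset_Icc_self hs)
        rw [hZx s hs', hWK _ (hxK s hs')]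
        exact hZd s hs' G hG.continuous (Eventually.of_forall fun _ => rfl))
      hYc.continuousOn (fun s _ => (hY s).hasDerivWithinAt) (by rw [hZ0, hY0, hx0])
    rw [← hZx t ht, this (right_mem_Icc.2 ht.1)]

end Unicycle

end Solutions

/-! ### A single ellipsoidal barrier -/

section SingleBarrier

open Set Filter Metric
open scoped Topology NNReal

lemma LocallyLipschitz.contDiff_fst {f : EuclideanSpace ℝ (Fin 2) → ℝ} (hf : ContDiff ℝ 1 f) :
    LocallyLipschitz fun x : Unicycle.State => f x.1 :=
  hf.locallyLipschitz.comp LipschitzWith.prod_fst.locallyLipschitz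

namespace Unicycle.Barrier

variable (B : Barrier)

/-- The component `eᵀ P (cos x₃, sin x₃)` of `P e` along the heading. -/
noncomputable def radial (x : State) : ℝ := B.Pe x 0 * x.2.cos + B.Pe x 1 * x.2.sin

/-- The component `eᵀ P (-sin x₃, cos x₃)` of `P e` across the heading. -/
noncomputable def lateral (x : State) : ℝ := B.Pe x 0 * (-x.2.sin) + B.Pe x 1 * x.2.cos

/-- The quadratic form `eᵀ P e`. -/
noncomputable def quad (x : State) : ℝ :=
  (x.1 0 - B.center 0) * B.Pe x 0 + (x.1 1 - B.center 1) * B.Pe x 1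

lemma Pe_zero (x : State) :
    B.Pe x 0 = B.P 0 0 * (x.1 0 - B.center 0) + B.P 0 1 * (x.1 1 - B.center 1) := by
  simp [Pe]

lemma Pe_one (x : State) :
    B.Pe x 1 = B.P 1 0 * (x.1 0 - B.center 0) + B.P 1 1 * (x.1 1 - B.center 1) := by
  simp [Pe]

lemma h_eq (x : State) : B.h x = B.γ * (B.Δ ^ 2 - 1 / 2 * B.quad x) := by
  simp [h, quad, Pe, dotProduct, Fin.sum_univ_two]

lemma radial_sq_add_lateral_sq (x : State) : B.radial x ^ 2 + B.lateral x ^ 2 = ‖B.Pe x‖ ^ 2 := by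
  rw [EuclideanSpace.norm_sq_eq, Fin.sum_univ_two, Real.norm_eq_abs, Real.norm_eq_abs, sq_abs,
    sq_abs, radial, lateral]
  linear_combination (B.Pe x 0 ^ 2 + B.Pe x 1 ^ 2) * x.2.cos_sq_add_sin_sq

lemma abs_radial_le (x : State) : |B.radial x| ≤ ‖B.Pe x‖ :=
  abs_le_of_sq_le_sq (by nlinarith [B.radial_sq_add_lateral_sq x, sq_nonneg (B.lateral x)])
    (norm_nonneg _)

lemma abs_lateral_le (x : State) : |B.lateral x| ≤ ‖B.Pe x‖ :=
  abs_le_of_sq_le_sq (by nlinarith [B.radial_sq_add_lateral_sq x, sq_nonneg (B.radial x)])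
    (norm_nonneg _)

lemma safetyControl_eq (x : State) : B.safetyControl x =
    (-(B.kp * B.γ * |B.h x| * B.radial x), -(B.kd * B.lateral x)) := by
  refine Prod.ext ?_ ?_
  · simp only [safetyControl, radial]
    split_ifs with h
    · rw [abs_of_nonneg h]; ring
    · rw [abs_of_neg (not_le.1 h)]; ring
  · simp only [safetyControl, lateral]
    ring

lemma contDiff_Pe (i : Fin 2) :
    ContDiff ℝ 1 fun z : EuclideanSpace ℝ (Fin 2) => B.Pe (z, 0) i := by
  fin_cases i
  · simp only [Fin.zero_eta, Pe_zero]
    fun_prop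
  · simp only [Fin.mk_one, Pe_one]
    fun_prop

lemma locallyLipschitz_Pe (i : Fin 2) : LocallyLipschitz fun x => B.Pe x i :=
  LocallyLipschitz.contDiff_fst (B.contDiff_Pe i)

lemma locallyLipschitz_h : LocallyLipschitz B.h := by
  have : ContDiff ℝ 1 fun z : EuclideanSpace ℝ (Fin 2) => B.h (z, 0) := by
    have h0 := B.contDiff_Pe 0
    have h1 := B.contDiff_Pe 1
    simp only [h_eq, quad]
    fun_prop
  exact LocallyLipschitz.contDiff_fst this

lemma continuous_h : Continuous B.h := B.locallyLipschitz_h.continuous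

lemma isClosed_safeSet : IsClosed B.safeSet := isClosed_le continuous_const B.continuous_h

lemma locallyLipschitz_cos : LocallyLipschitz fun x : State => x.2.cos :=
  Real.Angle.lipschitzWith_cos.locallyLipschitz.comp LipschitzWith.prod_snd.locallyLipschitz

lemma locallyLipschitz_sin : LocallyLipschitz fun x : State => x.2.sin :=
  Real.Angle.lipschitzWith_sin.locallyLipschitz.comp LipschitzWith.prod_snd.locallyLipschitz

lemma locallyLipschitz_radial : LocallyLipschitz B.radial :=
  ((B.locallyLipschitz_Pe 0).mul_real locallyLipschitz_cos).add
    ((B.locallyLipschitz_Pe 1).mul_real locallyLipschitz_sin)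

lemma locallyLipschitz_lateral : LocallyLipschitz B.lateral :=
  ((B.locallyLipschitz_Pe 0).mul_real locallyLipschitz_sin.neg).add
    ((B.locallyLipschitz_Pe 1).mul_real locallyLipschitz_cos)

lemma locallyLipschitz_safetyControl : LocallyLipschitz B.safetyControl := by
  have habs : LocallyLipschitz fun x => |B.h x| :=
    (lipschitzWith_one_norm (E := ℝ)).locallyLipschitz.comp B.locallyLipschitz_h
  have h1 := (((LocallyLipschitz.const (B.kp * B.γ)).mul_real habs).mul_real
    B.locallyLipschitz_radial).neg
  have h2 := ((LocallyLipschitz.const B.kd).mul_real B.locallyLipschitz_lateral).neg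
  rw [funext B.safetyControl_eq]
  exact h1.prodMk h2

lemma continuous_Pe : Continuous B.Pe := by
  have : Continuous fun x => (B.Pe x).ofLp :=
    continuous_pi fun i => (B.locallyLipschitz_Pe i).continuous
  exact (PiLp.continuous_toLp 2 _).comp this

section Derivatives

variable {Z : ℝ → EuclideanSpace ℝ (Fin 2) × ℝ} {V : EuclideanSpace ℝ (Fin 2) × ℝ} {s : Set ℝ}
  {t : ℝ}

lemma hasDerivWithinAt_Pe_zero (hZ : HasDerivWithinAt Z V s t) :
    HasDerivWithinAt (fun r => B.Pe (lift (Z r)) 0) (B.P 0 0 * V.1 0 + B.P 0 1 * V.1 1) s t := by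
  have h0 := hasDerivWithinAt_euclidean_apply hZ.fst 0
  have h1 := hasDerivWithinAt_euclidean_apply hZ.fst 1
  simp only [Pe_zero, lift]
  exact ((h0.sub_const _).const_mul _).add ((h1.sub_const _).const_mul _)

lemma hasDerivWithinAt_Pe_one (hZ : HasDerivWithinAt Z V s t) :
    HasDerivWithinAt (fun r => B.Pe (lift (Z r)) 1) (B.P 1 0 * V.1 0 + B.P 1 1 * V.1 1) s t := by
  have h0 := hasDerivWithinAt_euclidean_apply hZ.fst 0
  have h1 := hasDerivWithinAt_euclidean_apply hZ.fst 1
  simp only [Pe_one, lift]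
  exact ((h0.sub_const _).const_mul _).add ((h1.sub_const _).const_mul _)

lemma hasDerivWithinAt_h (hP : B.P 1 0 = B.P 0 1) (hZ : HasDerivWithinAt Z V s t) :
    HasDerivWithinAt (fun r => B.h (lift (Z r)))
      (-B.γ * (B.Pe (lift (Z t)) 0 * V.1 0 + B.Pe (lift (Z t)) 1 * V.1 1)) s t := by
  have h0 := hasDerivWithinAt_euclidean_apply hZ.fst 0
  have h1 := hasDerivWithinAt_euclidean_apply hZ.fst 1
  have p0 := B.hasDerivWithinAt_Pe_zero hZ
  have p1 := B.hasDerivWithinAt_Pe_one hZ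
  simp only [h_eq, quad]
  refine ((((((h0.sub_const (B.center 0)).mul p0).add
    ((h1.sub_const (B.center 1)).mul p1)).const_mul (1 / 2)).const_sub
      (B.Δ ^ 2)).const_mul B.γ).congr_deriv ?_
  simp only [Pe_zero, Pe_one, lift, hP]
  ring

lemma hasDerivWithinAt_radial (hZ : HasDerivWithinAt Z V s t) :
    HasDerivWithinAt (fun r => B.radial (lift (Z r)))
      ((B.P 0 0 * V.1 0 + B.P 0 1 * V.1 1) * (lift (Z t)).2.cos
        + (B.P 1 0 * V.1 0 + B.P 1 1 * V.1 1) * (lift (Z t)).2.sin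
        + V.2 * B.lateral (lift (Z t))) s t := by
  have p0 := B.hasDerivWithinAt_Pe_zero hZ
  have p1 := B.hasDerivWithinAt_Pe_one hZ
  have h2 : HasDerivWithinAt (fun r => (Z r).2) V.2 s t := hZ.snd
  have hc : HasDerivWithinAt (fun r => (lift (Z r)).2.cos) (-Real.sin (Z t).2 * V.2) s t := by
    simpa [lift] using h2.cos
  have hs : HasDerivWithinAt (fun r => (lift (Z r)).2.sin) (Real.cos (Z t).2 * V.2) s t := by
    simpa [lift] using h2.sin
  refine ((p0.mul hc).add (p1.mul hs)).congr_deriv ?_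
  simp only [lateral, lift, Real.Angle.sin_coe, Real.Angle.cos_coe]
  ring

end Derivatives

namespace Admissible

variable {B}

lemma γ_sq (hB : B.Admissible) : B.γ ^ 2 = 1 := by
  rcases hB.γ_eq with h | h <;> rw [h] <;> norm_num

lemma P_symm (hB : B.Admissible) : B.P 1 0 = B.P 0 1 := by
  simpa using (hB.P_posDef.isHermitian.apply 0 1)

lemma trace_pos (hB : B.Admissible) : 0 < B.P 0 0 + B.P 1 1 :=
  add_pos hB.P_posDef.diag_pos hB.P_posDef.diag_pos

lemma det_pos (hB : B.Admissible) : 0 < B.P 0 0 * B.P 1 1 - B.P 0 1 ^ 2 := by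
  have := hB.P_posDef.det_pos
  rw [Matrix.det_fin_two, hB.P_symm] at this
  linarith

lemma Pe_ne_zero (hB : B.Admissible) {x : State} (hx : x.1 ≠ B.center) : B.Pe x ≠ 0 := by
  intro h
  apply hx
  have h0 : B.Pe x 0 = 0 := by rw [h]; rfl
  have h1 : B.Pe x 1 = 0 := by rw [h]; rfl
  have hd := hB.det_pos
  rw [Pe_zero] at h0
  rw [Pe_one, hB.P_symm] at h1
  -- Multiply `P e = 0` by the adjugate of `P`.
  have e0 : (B.P 0 0 * B.P 1 1 - B.P 0 1 ^ 2) * (x.1 0 - B.center 0) = 0 := by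
    linear_combination B.P 1 1 * h0 - B.P 0 1 * h1
  have e1 : (B.P 0 0 * B.P 1 1 - B.P 0 1 ^ 2) * (x.1 1 - B.center 1) = 0 := by
    linear_combination B.P 0 0 * h1 - B.P 0 1 * h0
  ext i
  fin_cases i
  · exact sub_eq_zero.1 ((mul_eq_zero.1 e0).resolve_left hd.ne')
  · exact sub_eq_zero.1 ((mul_eq_zero.1 e1).resolve_left hd.ne')

/-- By Cayley-Hamilton `(tr P) P = (det P) I + P²`, hence `(det P) |e|² ≤ (tr P) eᵀ P e`. -/
lemma isCompact_quad_le (hB : B.Admissible) (r : ℝ) : IsCompact {x | B.quad x ≤ r} := by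
  set τ := B.P 0 0 + B.P 1 1
  set d := B.P 0 0 * B.P 1 1 - B.P 0 1 ^ 2
  have hd : 0 < d := hB.det_pos
  have hsub : {x : State | B.quad x ≤ r} ⊆ closedBall B.center (Real.sqrt (τ * r / d)) ×ˢ univ := by
    intro x hx
    refine ⟨?_, mem_univ _⟩
    rw [mem_closedBall, EuclideanSpace.dist_eq, Fin.sum_univ_two, Real.dist_eq, Real.dist_eq,
      sq_abs, sq_abs]
    refine Real.sqrt_le_sqrt ((le_div_iff₀ hd).2 ?_)
    have hid : τ * B.quad x = d * ((x.1 0 - B.center 0) ^ 2 + (x.1 1 - B.center 1) ^ 2)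
        + (B.Pe x 0 ^ 2 + B.Pe x 1 ^ 2) := by
      simp only [τ, d, quad, Pe_zero, Pe_one, hB.P_symm]
      ring
    have := mul_le_mul_of_nonneg_left (show B.quad x ≤ r from hx) hB.trace_pos.le
    have h0 := sq_nonneg (B.Pe x 0)
    have h1 := sq_nonneg (B.Pe x 1)
    linarith
  have hq : Continuous B.quad := by
    have h0 := (B.locallyLipschitz_Pe 0).continuous
    have h1 := (B.locallyLipschitz_Pe 1).continuous
    have : ∀ i : Fin 2, Continuous fun x : State => x.1 i := fun i =>
      (EuclideanSpace.proj (𝕜 := ℝ) i).continuous.comp continuous_fst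
    exact (((this 0).sub continuous_const).mul h0).add (((this 1).sub continuous_const).mul h1)
  exact ((isCompact_closedBall _ _).prod Real.Angle.isCompact_univ).of_isClosed_subset
    (isClosed_le hq continuous_const) hsub

lemma quad_eq (hB : B.Admissible) (x : State) : B.quad x = 2 * (B.Δ ^ 2 - B.γ * B.h x) := by
  rw [h_eq]
  linear_combination (2 * B.Δ ^ 2 - B.quad x) * hB.γ_sq

lemma isCompact_of_isClosed (hB : B.Admissible) {s : Set State} (hs : IsClosed s) {c : ℝ}
    (hc : ∀ x ∈ s, -(B.γ * B.h x) ≤ c) : IsCompact s :=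
  (hB.isCompact_quad_le (2 * (B.Δ ^ 2 + c))).of_isClosed_subset hs fun x hx => by
    show B.quad x ≤ _
    rw [hB.quad_eq]
    linarith [hc x hx]

lemma isCompact_h_mem_Icc (hB : B.Admissible) (p q : ℝ) : IsCompact {x | B.h x ∈ Icc p q} :=
  hB.isCompact_of_isClosed (c := max q (-p)) (isClosed_Icc.preimage B.continuous_h) fun x hx => by
    rcases hB.γ_eq with h | h <;> rw [h]
    · exact le_max_of_le_right (by linarith [hx.1])
    · exact le_max_of_le_left (by linarith [hx.2])

/-- The values of the form `e ↦ γ (Δ² - ½ eᵀ P e)` fill an unbounded interval that ends at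
`γ Δ²`. -/
lemma exists_h_eq (hB : B.Admissible) {c : ℝ} (hc : B.γ * c ≤ B.Δ ^ 2) : ∃ x, B.h x = c := by
  have hp : 0 < B.P 0 0 := hB.P_posDef.diag_pos
  set r := Real.sqrt (2 * (B.Δ ^ 2 - B.γ * c) / B.P 0 0)
  have hr : r ^ 2 = 2 * (B.Δ ^ 2 - B.γ * c) / B.P 0 0 :=
    Real.sq_sqrt (div_nonneg (by linarith) hp.le)
  refine ⟨(!₂[B.center 0 + r, B.center 1], 0), ?_⟩
  have hq : B.quad (!₂[B.center 0 + r, B.center 1], 0) = 2 * (B.Δ ^ 2 - B.γ * c) := by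
    have : B.P 0 0 * r ^ 2 = 2 * (B.Δ ^ 2 - B.γ * c) := by rw [hr]; field_simp
    simp [quad, Pe_zero]
    linarith
  rw [h_eq, hq]
  linear_combination c * hB.γ_sq

lemma safeSet_nonempty (hB : B.Admissible) : B.safeSet.Nonempty := by
  obtain ⟨x, hx⟩ := hB.exists_h_eq (c := 0) (by simpa using sq_nonneg B.Δ)
  exact ⟨x, hx.ge⟩

end Admissible

end Unicycle.Barrier

end SingleBarrier

/-! ### The mixed-initiative controller near the annuli -/

section Mixed

open Set Filter Metric
open scoped Topology NNReal

namespace Unicycle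

namespace Barrier.Admissible

variable {B : Barrier}

lemma φ_eq_κ (hB : B.Admissible) (s : ℝ) : B.φ s = B.κ (max 0 (min B.a s)) := by
  have ha := hB.a_pos
  rw [φ]
  split_ifs with h1 h2
  · rw [min_eq_left h1.le, max_eq_right ha.le, hB.κ_a]
  · rw [min_eq_right (not_lt.1 h1), max_eq_right h2]
  · rw [min_eq_right (not_lt.1 h1), max_eq_left (not_le.1 h2).le, hB.κ_zero]

lemma φ_mem (hB : B.Admissible) (s : ℝ) : B.φ s ∈ Icc (0 : ℝ) 1 := by
  rw [hB.φ_eq_κ]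
  exact hB.κ_mem _

lemma φ_of_nonpos (hB : B.Admissible) {s : ℝ} (hs : s ≤ 0) : B.φ s = 0 := by
  rw [hB.φ_eq_κ, max_eq_left ((min_le_right _ _).trans hs), hB.κ_zero]

lemma φ_of_le (hB : B.Admissible) {s : ℝ} (hs : B.a ≤ s) : B.φ s = 1 := by
  rw [hB.φ_eq_κ, min_eq_left hs, max_eq_right hB.a_pos.le, hB.κ_a]

lemma locallyLipschitz_φ (hB : B.Admissible) : LocallyLipschitz B.φ := by
  rw [funext hB.φ_eq_κ]
  exact hB.κ_lipschitz.comp ((LocallyLipschitz.id.const_min _).const_max _)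

end Barrier.Admissible

variable {N : ℕ} {B : Fin N → Barrier} {unom : State → Input}

lemma mixedControl_of_mem_annulus (hdisj : ∀ i j, i ≠ j → (B i).annulus ∩ (B j).annulus = ∅)
    {i : Fin N} {x : State} (hx : x ∈ (B i).annulus) :
    mixedControl B unom x = (1 - (B i).φ ((B i).h x)) • (B i).safetyControl x
      + (B i).φ ((B i).h x) • unom x := by
  have hex : ∃ j, x ∈ (B j).annulus := ⟨i, hx⟩
  have hi : hex.choose = i := by
    by_contra hne
    exact (hdisj _ _ hne).subset ⟨hex.choose_spec, hx⟩
  rw [mixedControl, φBar, uBar, dif_pos hex, dif_pos hex, hi]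

lemma mixedControl_of_notMem_annulus {x : State} (hx : ∀ i, x ∉ (B i).annulus) :
    mixedControl B unom x = unom x := by
  have hex : ¬ ∃ j, x ∈ (B j).annulus := fun ⟨i, hi⟩ => hx i hi
  rw [mixedControl, φBar, uBar, dif_neg hex, dif_neg hex]
  simp

lemma mixedControl_of_h_nonpos (hB : ∀ i, (B i).Admissible)
    (hdisj : ∀ i j, i ≠ j → (B i).annulus ∩ (B j).annulus = ∅) {i : Fin N} {x : State}
    (hx : (B i).h x ∈ Icc (-(B i).b) 0) : mixedControl B unom x = (B i).safetyControl x := by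
  have hmem : x ∈ (B i).annulus := ⟨hx.1, hx.2.trans (hB i).a_pos.le⟩
  rw [mixedControl_of_mem_annulus hdisj hmem, (hB i).φ_of_nonpos hx.2]
  simp

/-- A locally Lipschitz feedback on the whole state space that agrees with the mixed control
on the operating region, away from the outer jumps at `h_i = -b_i`. -/
noncomputable def smoothedControl (B : Fin N → Barrier) (unom : State → Input) (x : State) :
    Input :=
  unom x + ∑ i, (1 - (B i).φ ((B i).h x)) • ((B i).safetyControl x - unom x)

lemma mixedControl_eq_smoothedControl (hB : ∀ i, (B i).Admissible)
    (hdisj : ∀ i j, i ≠ j → (B i).annulus ∩ (B j).annulus = ∅) {x : State}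
    (hx : x ∈ operatingRegion B) : mixedControl B unom x = smoothedControl B unom x := by
  have hφ : ∀ i, x ∉ (B i).annulus → (B i).φ ((B i).h x) = 1 := fun i hi =>
    (hB i).φ_of_le (not_lt.1 fun hlt => hi ⟨(hx i).le, hlt.le⟩)
  by_cases hex : ∃ i, x ∈ (B i).annulus
  · obtain ⟨i, hi⟩ := hex
    rw [mixedControl_of_mem_annulus hdisj hi, smoothedControl, Finset.sum_eq_single i]
    · module
    · intro j _ hji
      rw [hφ j fun hj => (hdisj j i hji).subset ⟨hj, hi⟩, sub_self, zero_smul]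
    · simp
  · have hex' : ∀ i, x ∉ (B i).annulus := fun i hi => hex ⟨i, hi⟩
    rw [mixedControl_of_notMem_annulus hex', smoothedControl, Finset.sum_eq_zero, add_zero]
    intro i _
    rw [hφ i (hex' i), sub_self, zero_smul]

lemma locallyLipschitz_smoothedControl (hB : ∀ i, (B i).Admissible) (hnom : LocallyLipschitz unom) :
    LocallyLipschitz (smoothedControl B unom) := by
  refine hnom.add (LocallyLipschitz.finset_sum _ fun i => ?_)
  have h1 : LocallyLipschitz fun x => 1 - (B i).φ ((B i).h x) :=
    (LocallyLipschitz.const 1).sub ((hB i).locallyLipschitz_φ.comp (B i).locallyLipschitz_h)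
  have h2 : LocallyLipschitz fun x => (B i).safetyControl x - unom x :=
    (B i).locallyLipschitz_safetyControl.sub hnom
  exact (h1.mul_real (LipschitzWith.prod_fst.locallyLipschitz.comp h2)).prodMk
    (h1.mul_real (LipschitzWith.prod_snd.locallyLipschitz.comp h2))

/-! ### Monotonicity of the barrier along solutions, and safety -/

lemma Barrier.Admissible.hasDerivWithinAt_h_comp {B : Barrier} (hB : B.Admissible)
    {u : State → Input} {x : ℝ → State} {T : EReal} (hx : IsSolution u x T) {t : ℝ}
    (ht : t ∈ timeDomain T) (hu : ∀ᶠ s in 𝓝[≥] t, u (x s) = B.safetyControl (x s))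
    (hle : B.h (x t) ≤ 0) :
    HasDerivWithinAt (fun s => B.h (x s)) (-B.kp * B.h (x t) * B.radial (x t) ^ 2) (Ici t) t := by
  obtain ⟨Z, -, hZx, -, hZd⟩ := hx.exists_lift (x 0).2.coe_toReal
  have hd := B.hasDerivWithinAt_h hB.P_symm
    (hZd t ht _ B.locallyLipschitz_safetyControl.continuous hu)
  obtain ⟨r, htr, hr⟩ := exists_gt_mem_timeDomain ht
  refine (hd.congr_of_eventuallyEq ?_ (by rw [hZx t ht])).congr_deriv ?_
  · filter_upwards [Icc_mem_nhdsGE htr] with s hs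
    rw [hZx s (Icc_subset_timeDomain ht hr hs)]
  · rw [hZx t ht]
    simp only [field, B.safetyControl_eq, abs_of_nonpos hle, Matrix.cons_val_zero,
      Matrix.cons_val_one, Barrier.radial]
    linear_combination (-B.kp * B.h (x t) * (B.Pe (x t) 0 * (x t).2.cos
      + B.Pe (x t) 1 * (x t).2.sin) ^ 2) * hB.γ_sq

/-- Below the level zero, and down to the level `-b`, the speed of the safety controller makes
`h` nondecreasing: `ḣ = -k_p h (eᵀ P (cos x₃, sin x₃))² ≥ 0`. -/
lemma min_h_zero_le (hB : ∀ i, (B i).Admissible)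
    (hdisj : ∀ i j, i ≠ j → (B i).annulus ∩ (B j).annulus = ∅) {x : ℝ → State} {T : EReal}
    (hx : IsSolution (mixedControl B unom) x T) {i : Fin N} {t₀ t₁ : ℝ} (h₀ : t₀ ∈ timeDomain T)
    (h₁ : t₁ ∈ timeDomain T) (h₀₁ : t₀ ≤ t₁) (hb : -(B i).b < (B i).h (x t₀)) :
    min ((B i).h (x t₀)) 0 ≤ (B i).h (x t₁) := by
  by_contra! hlt
  set g : ℝ → ℝ := fun t => (B i).h (x t)
  set m := min (g t₀) 0
  have hbm : -(B i).b < m := lt_min hb (by linarith [(hB i).b_pos])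
  have hg : ContinuousOn g (Icc t₀ t₁) :=
    (B i).continuous_h.comp_continuousOn (hx.continuousOn.mono (Icc_subset_timeDomain h₀ h₁))
  -- `s` is the last time at which the level `m` is attained.
  obtain ⟨s, ⟨hs, hms⟩, hmax⟩ : ∃ s, IsGreatest {t | t ∈ Icc t₀ t₁ ∧ m ≤ g t} s := by
    have hcl : IsClosed (Icc t₀ t₁ ∩ g ⁻¹' Ici m) :=
      hg.preimage_isClosed_of_isClosed isClosed_Icc isClosed_Ici
    exact (isCompact_Icc.of_isClosed_subset hcl inter_subset_left).exists_isGreatest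
      ⟨t₀, left_mem_Icc.2 h₀₁, mem_preimage.2 (mem_Ici.2 (min_le_left _ _))⟩
  have hst : s < t₁ := lt_of_le_of_ne hs.2 fun h => absurd hms (not_le.2 (h ▸ hlt))
  have hafter : ∀ t ∈ Ioc s t₁, g t < m := fun t ht => by
    by_contra! h
    exact absurd (hmax ⟨⟨hs.1.trans ht.1.le, ht.2⟩, h⟩) (not_le.2 ht.1)
  have hgs : ContinuousWithinAt g (Icc s t₁) s :=
    (hg s hs).mono (Icc_subset_Icc_left hs.1)
  have hsm : g s ≤ m := by
    have h1 : ContinuousWithinAt g (Ioc s t₁) s := hgs.mono Ioc_subset_Icc_self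
    have : (𝓝[Ioc s t₁] s).NeBot := by
      rw [nhdsWithin_Ioc_eq_nhdsGT hst]
      infer_instance
    refine le_of_tendsto h1.tendsto ?_
    filter_upwards [self_mem_nhdsWithin] with t ht
    exact (hafter t ht).le
  obtain ⟨r, hr, hgr⟩ : ∃ r, s < r ∧ ∀ t ∈ Ico s r, t ≤ t₁ → -(B i).b < g t := by
    have h1 : ∀ᶠ t in 𝓝[≥] s, -(B i).b < g t := by
      rw [← nhdsWithin_Icc_eq_nhdsGE hst]
      exact hgs.tendsto.eventually_const_lt (hbm.trans_le hms)
    obtain ⟨r, hr, hsub⟩ := (mem_nhdsGE_iff_exists_Ico_subset).1 h1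
    exact ⟨r, hr, fun t ht _ => hsub ht⟩
  obtain ⟨t₂, hst₂, ht₂⟩ := exists_between (lt_min hr hst)
  have ht₂r : t₂ < r := ht₂.trans_le (min_le_left _ _)
  have ht₂₁ : t₂ < t₁ := ht₂.trans_le (min_le_right _ _)
  have hmem : ∀ t ∈ Icc s t₂, g t ∈ Icc (-(B i).b) 0 := fun t ht => by
    refine ⟨(hgr t ⟨ht.1, ht.2.trans_lt ht₂r⟩ (ht.2.trans ht₂₁.le)).le, ?_⟩
    rcases eq_or_lt_of_le ht.1 with rfl | h
    · exact hsm.trans (min_le_right _ _)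
    · exact (hafter t ⟨h, ht.2.trans ht₂₁.le⟩).le.trans (min_le_right _ _)
  have hsD : ∀ t ∈ Icc s t₂, t ∈ timeDomain T := fun t ht =>
    Icc_subset_timeDomain h₀ h₁ ⟨hs.1.trans ht.1, ht.2.trans ht₂₁.le⟩
  have hd : ∀ t ∈ Ico s t₂, HasDerivWithinAt (fun t => -g t)
      (-(-(B i).kp * (B i).h (x t) * (B i).radial (x t) ^ 2)) (Ici t) t := fun t ht => by
    refine ((hB i).hasDerivWithinAt_h_comp hx (hsD t (Ico_subset_Icc_self ht)) ?_
      (hmem t (Ico_subset_Icc_self ht)).2).neg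
    filter_upwards [Icc_mem_nhdsGE ht.2] with r hr
    exact mixedControl_of_h_nonpos hB hdisj (hmem r ⟨ht.1.trans hr.1, hr.2⟩)
  have := image_le_of_deriv_right_le_deriv_boundary (B := fun _ => -g s) (B' := fun _ => 0)
    ((hg.mono (Icc_subset_Icc hs.1 ht₂₁.le)).neg) hd le_rfl continuousOn_const
    (fun t _ => hasDerivWithinAt_const _ _ _)
    (fun t ht => by
      have h1 := (hmem t (Ico_subset_Icc_self ht)).2
      have h2 := mul_nonneg (mul_nonneg (hB i).kp_pos.le (neg_nonneg.2 h1))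
        (sq_nonneg ((B i).radial (x t)))
      show -(-(B i).kp * g t * (B i).radial (x t) ^ 2) ≤ 0
      linarith)
    (right_mem_Icc.2 hst₂.le)
  have h3 := hafter t₂ ⟨hst₂, ht₂₁.le⟩
  rw [Pi.neg_apply] at this
  linarith

theorem isSafe_safeSet (hB : ∀ i, (B i).Admissible)
    (hdisj : ∀ i j, i ≠ j → (B i).annulus ∩ (B j).annulus = ∅) (i : Fin N) :
    IsSafe (mixedControl B unom) (B i).safeSet := by
  intro x T hx h0 t ht
  have h0' : 0 ≤ (B i).h (x 0) := h0
  have := min_h_zero_le hB hdisj hx (i := i) (zero_mem_timeDomain hx.pos) ht ht.1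
    (by linarith [(hB i).b_pos])
  rwa [min_eq_right h0'] at this

/-! ### Input constraints -/

lemma Barrier.Admissible.norm_Pe_le_η {B : Barrier} (hB : B.Admissible) {x : State}
    (hx : x ∈ B.annulus) : ‖B.Pe x‖ ≤ B.η :=
  le_csSup ((hB.isCompact_h_mem_Icc _ _).image B.continuous_Pe.norm).bddAbove ⟨x, hx, rfl⟩

/-- The annulus contains a point off the center, on the boundary level `h = -b` (`γ = 1`) or
`h = a` (`γ = -1`). -/
lemma Barrier.Admissible.η_pos {B : Barrier} (hB : B.Admissible) : 0 < B.η := by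
  have ha := hB.a_pos
  have hb := hB.b_pos
  have key : ∀ c, c ∈ Icc (-B.b) B.a → B.γ * c < 0 → 0 < B.η := by
    intro c hc hneg
    obtain ⟨x, hx⟩ := hB.exists_h_eq (c := c) (hneg.le.trans (sq_nonneg _))
    have hq := hB.quad_eq x
    refine (norm_pos_iff.2 fun h0 => ?_).trans_le (hB.norm_Pe_le_η (x := x) (by
      show B.h x ∈ Icc (-B.b) B.a
      rwa [hx]))
    have : B.quad x = 0 := by simp [Barrier.quad, h0]
    rw [this, hx] at hq
    nlinarith [sq_nonneg B.Δ]
  rcases hB.γ_eq with h | h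
  · exact key (-B.b) ⟨le_rfl, by linarith⟩ (by rw [h]; linarith)
  · exact key B.a ⟨by linarith, le_rfl⟩ (by rw [h]; linarith)

lemma Barrier.Admissible.safetyControl_mem_inputBox {B : Barrier} (hB : B.Admissible) {up ud : ℝ}
    (hp : B.kp ≤ up / (B.η * max B.a B.b)) (hd : B.kd ≤ ud / B.η) {x : State}
    (hx : x ∈ B.annulus) : B.safetyControl x ∈ inputBox up ud := by
  have hη := hB.η_pos
  have hmax : 0 < max B.a B.b := lt_max_of_lt_left hB.a_pos
  rw [le_div_iff₀ (mul_pos hη hmax)] at hp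
  rw [le_div_iff₀ hη] at hd
  have hPe := hB.norm_Pe_le_η hx
  have hr := (B.abs_radial_le x).trans hPe
  have hl := (B.abs_lateral_le x).trans hPe
  have hh : |B.h x| ≤ max B.a B.b :=
    abs_le.2 ⟨by linarith [hx.1, le_max_right B.a B.b], hx.2.trans (le_max_left _ _)⟩
  have hγ : |B.γ| = 1 := by rcases hB.γ_eq with h | h <;> simp [h]
  rw [B.safetyControl_eq]
  constructor
  · show |-(B.kp * B.γ * |B.h x| * B.radial x)| ≤ up
    rw [abs_neg, abs_mul, abs_mul, abs_mul, abs_abs, hγ, abs_of_pos hB.kp_pos, mul_one, mul_assoc]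
    refine le_trans (mul_le_mul_of_nonneg_left ?_ hB.kp_pos.le) hp
    rw [mul_comm]
    exact mul_le_mul hr hh (abs_nonneg _) hη.le
  · show |-(B.kd * B.lateral x)| ≤ ud
    rw [abs_neg, abs_mul, abs_of_pos hB.kd_pos]
    exact (mul_le_mul_of_nonneg_left hl hB.kd_pos.le).trans hd

lemma convex_inputBox (up ud : ℝ) : Convex ℝ (inputBox up ud) := by
  have : inputBox up ud = Icc (-up) up ×ˢ Icc (-ud) ud := by
    ext u
    simp only [inputBox, abs_le, mem_prod, mem_Icc]
    rfl
  rw [this]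
  exact (convex_Icc _ _).prod (convex_Icc _ _)

theorem mixedControl_mem_inputBox (hB : ∀ i, (B i).Admissible)
    (hdisj : ∀ i j, i ≠ j → (B i).annulus ∩ (B j).annulus = ∅) {up ud : ℝ}
    (hnom : ∀ x, unom x ∈ inputBox up ud)
    (hk : ∀ i, (B i).kp ≤ up / ((B i).η * max (B i).a (B i).b) ∧ (B i).kd ≤ ud / (B i).η)
    (x : State) : mixedControl B unom x ∈ inputBox up ud := by
  by_cases hex : ∃ i, x ∈ (B i).annulus
  · obtain ⟨i, hi⟩ := hex
    rw [mixedControl_of_mem_annulus hdisj hi]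
    have hφ := (hB i).φ_mem ((B i).h x)
    exact convex_inputBox up ud ((hB i).safetyControl_mem_inputBox (hk i).1 (hk i).2 hi) (hnom x)
      (by linarith [hφ.2]) hφ.1 (by ring)
  · rw [mixedControl_of_notMem_annulus fun i hi => hex ⟨i, hi⟩]
    exact hnom x

end Unicycle

end Mixed

/-! ### Global bounded solutions when an ellipse is to be kept inside -/

section GlobalExistence

open Set Filter Metric
open scoped Topology NNReal

namespace Unicycle

variable {N : ℕ} {B : Fin N → Barrier} {unom : State → Input}

/-- One constraint `h_i > -b_i` with `γ_i = 1` bounds the position, so every `x₀` in the operating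
region has a compact neighborhood `K` of the form `{h_j ≥ c_j ∀ j}` which solutions from `x₀`
cannot leave, because `h_j` stays above `min (h_j x₀) 0 > c_j`. -/
theorem globalBoundedFrom_operatingRegion (hB : ∀ i, (B i).Admissible)
    (hdisj : ∀ i j, i ≠ j → (B i).annulus ∩ (B j).annulus = ∅) (hnom : LocallyLipschitz unom)
    (hγ : ∃ i, (B i).γ = 1) :
    GlobalBoundedFrom (mixedControl B unom) (operatingRegion B) := by
  obtain ⟨i₀, hi₀⟩ := hγ
  intro x₀ hx₀
  set m : Fin N → ℝ := fun i => min ((B i).h x₀) 0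
  set c : Fin N → ℝ := fun i => (m i - (B i).b) / 2
  have hbm : ∀ i, -(B i).b < m i := fun i => lt_min (hx₀ i) (by linarith [(hB i).b_pos])
  have hc : ∀ i, c i = (m i - (B i).b) / 2 := fun _ => rfl
  have hbc : ∀ i, -(B i).b < c i := fun i => by linarith [hbm i, hc i]
  have hcm : ∀ i, c i < m i := fun i => by linarith [hbm i, hc i]
  set K : Set State := {x | ∀ i, c i ≤ (B i).h x}
  set O : Set State := {x | ∀ i, c i < (B i).h x}
  have hO : IsOpen O := by
    simp only [O, ofPred_forall]
    exact isOpen_iInter_of_finite fun i => isOpen_lt continuous_const (B i).continuous_h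
  have hOK : O ⊆ K := fun x hx i => (hx i).le
  have hKR : K ⊆ operatingRegion B := fun x hx i => (hbc i).trans_le (hx i)
  have hKcl : IsClosed K := by
    simp only [K, ofPred_forall]
    exact isClosed_iInter fun i => isClosed_le continuous_const (B i).continuous_h
  have hKc : IsCompact K := (hB i₀).isCompact_of_isClosed hKcl (c := -c i₀) fun x hx => by
    rw [hi₀, one_mul]
    exact neg_le_neg (hx i₀)
  obtain ⟨y, hyc, hy0, hysol, hyuniq⟩ :=
    exists_flow (locallyLipschitz_smoothedControl hB hnom) hKc x₀
  have hsol : ∀ T : EReal, 0 < T → (∀ t ∈ timeDomain T, y t ∈ K) →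
      IsSolution (mixedControl B unom) y T := fun T hT hK =>
    (hysol T hT hK).congr fun t ht =>
      (mixedControl_eq_smoothedControl hB hdisj (hKR (hK t ht))).symm
  have hinv : ∀ (x : ℝ → State) (T : EReal), IsSolution (mixedControl B unom) x T → x 0 = x₀ →
      ∀ t ∈ timeDomain T, ∀ i, m i ≤ (B i).h (x t) := fun x T hx hx0 t ht i => by
    have := min_h_zero_le hB hdisj hx (i := i) (zero_mem_timeDomain hx.pos) ht ht.1
      (by rw [hx0]; exact hx₀ i)
    rwa [hx0] at this
  have hyK : ∀ t, 0 ≤ t → y t ∈ K := by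
    by_contra! hex
    -- `τ` is the first exit time from `K`.
    set S : Set ℝ := {t | 0 ≤ t ∧ y t ∉ K}
    have hSne : S.Nonempty := hex
    have hSbdd : BddBelow S := ⟨0, fun t ht => ht.1⟩
    set τ := sInf S
    have hτ0 : 0 ≤ τ := le_csInf hSne fun t ht => ht.1
    have hbefore : ∀ t, 0 ≤ t → t < τ → y t ∈ K := fun t h0 ht => by
      by_contra h
      exact absurd (csInf_le hSbdd (show t ∈ S from ⟨h0, h⟩)) (not_le.2 ht)
    have hτO : ∀ i, m i ≤ (B i).h (y τ) := by
      intro i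
      rcases eq_or_lt_of_le hτ0 with h | h
      · rw [← h, hy0]
        exact min_le_left _ _
      · have hs : IsSolution (mixedControl B unom) y (τ : EReal) :=
          hsol _ (by exact_mod_cast h) fun t ht =>
            hbefore t ht.1 (EReal.coe_lt_coe_iff.1 ht.2)
        have hle : ∀ᶠ t in 𝓝[<] τ, m i ≤ (B i).h (y t) := by
          filter_upwards [Ioo_mem_nhdsLT h] with t ht
          exact hinv y τ hs hy0 t (mem_timeDomain_coe.2 ⟨ht.1.le, ht.2⟩) i
        exact ge_of_tendsto
          ((((B i).continuous_h.comp hyc).tendsto τ).mono_left nhdsWithin_le_nhds) hle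
    have hmem : y ⁻¹' O ∈ 𝓝 τ := (hO.preimage hyc).mem_nhds fun i => (hcm i).trans_le (hτO i)
    obtain ⟨ε, hε, hball⟩ := Metric.mem_nhds_iff.1 hmem
    obtain ⟨t, ht, htτ⟩ := exists_lt_of_csInf_lt hSne (show sInf S < τ + ε by linarith)
    have hτt : τ ≤ t := csInf_le hSbdd ht
    refine ht.2 (hOK (hball ?_))
    rw [mem_ball, Real.dist_eq, abs_of_nonneg (by linarith)]
    linarith
  have hytop : IsSolution (mixedControl B unom) y ⊤ :=
    hsol ⊤ EReal.zero_lt_top fun t ht => hyK t ht.1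
  refine ⟨⟨y, ⊤, ⟨hytop, fun _ _ _ _ => not_top_lt⟩, hy0⟩, fun x T hx hx0 => ?_⟩
  have hxK : ∀ t ∈ timeDomain T, x t ∈ K := fun t ht i =>
    (hcm i).le.trans (hinv x T hx.1 hx0 t ht i)
  have hxy : EqOn x y (timeDomain T) := hyuniq x T
    (hx.1.congr fun t ht => mixedControl_eq_smoothedControl hB hdisj (hKR (hxK t ht))) hx0 hxK
  refine ⟨?_, hKc.isBounded.subset (image_subset_iff.2 hxK)⟩
  by_contra hT
  exact hx.2 y ⊤ hytop hxy (lt_top_iff_ne_top.2 hT)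

end Unicycle

end GlobalExistence

/-! ### Asymptotic stability -/

section Stability

open Set Filter Metric
open scoped Topology NNReal

namespace Unicycle

namespace Barrier.Admissible

variable {B : Barrier}

/-- Either `{h ≥ 0}` (`γ = 1`) or `{h ≤ -η}` (`γ = -1`) is compact, so these two sets have
a positive distance. -/
lemma exists_lt_h_of_infDist_lt (hB : B.Admissible) {η : ℝ} (hη : 0 < η) :
    ∃ δ > 0, ∀ x, infDist x B.safeSet < δ → -η < B.h x := by
  have hcl : IsClosed {x | B.h x ≤ -η} := isClosed_le B.continuous_h continuous_const
  have hdisj : Disjoint B.safeSet {x | B.h x ≤ -η} := by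
    refine disjoint_left.2 fun x (h1 : 0 ≤ B.h x) (h2 : B.h x ≤ -η) => ?_
    linarith
  obtain ⟨δ, hδ, hd⟩ : ∃ δ, 0 < δ ∧
      Disjoint (thickening δ B.safeSet) (thickening δ {x | B.h x ≤ -η}) := by
    rcases hB.γ_eq with h | h
    · refine hdisj.exists_thickenings (hB.isCompact_of_isClosed (B.isClosed_safeSet) (c := 0)
        fun x (hx : 0 ≤ B.h x) => ?_) hcl
      rw [h]
      linarith
    · obtain ⟨δ, hδ, hd⟩ := hdisj.symm.exists_thickenings (hB.isCompact_of_isClosed hcl (c := 0)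
        fun x (hx : B.h x ≤ -η) => by rw [h]; linarith) (B.isClosed_safeSet)
      exact ⟨δ, hδ, hd.symm⟩
  refine ⟨δ, hδ, fun x hx => not_le.1 fun hle => disjoint_left.1 hd ?_
    (self_subset_thickening hδ _ hle)⟩
  exact (mem_thickening_iff_infDist_lt hB.safeSet_nonempty).2 hx

/-- On the compact set of points with `-b ≤ h ≤ 0` that have distance at least `ε` from the safe
set, `h` attains a negative maximum. -/
lemma exists_infDist_lt_of_lt_h (hB : B.Admissible) {ε : ℝ} (hε : 0 < ε) :
    ∃ η > 0, η ≤ B.b ∧ ∀ x, -η < B.h x → infDist x B.safeSet < ε := by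
  set S : Set State := {x | B.h x ∈ Icc (-B.b) 0} ∩ {x | ε ≤ infDist x B.safeSet}
  have hS : IsCompact S := (hB.isCompact_h_mem_Icc _ _).inter_right
    (isClosed_le continuous_const (continuous_infDist_pt _))
  have hsafe : ∀ x, 0 ≤ B.h x → infDist x B.safeSet < ε := fun x hx => by
    rwa [infDist_zero_of_mem (show x ∈ B.safeSet from hx)]
  rcases S.eq_empty_or_nonempty with hempty | hne
  · refine ⟨B.b, hB.b_pos, le_rfl, fun x hx => ?_⟩
    by_contra! h
    have hx0 : B.h x < 0 := not_le.1 fun h0 => absurd (hsafe x h0) (not_lt.2 h)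
    exact hempty.subset (show x ∈ S from ⟨⟨hx.le, hx0.le⟩, h⟩)
  · obtain ⟨p, hp, hmax⟩ := hS.exists_isMaxOn hne B.continuous_h.continuousOn
    have hp0 : B.h p < 0 := not_le.1 fun h0 => absurd (hsafe p h0) (not_lt.2 hp.2)
    refine ⟨-B.h p, neg_pos.2 hp0, by linarith [hp.1.1], fun x hx => ?_⟩
    by_contra! h
    have hx0 : B.h x < 0 := not_le.1 fun h0 => absurd (hsafe x h0) (not_lt.2 h)
    have : B.h x ≤ B.h p := hmax ⟨⟨by linarith [hp.1.1], hx0.le⟩, h⟩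
    linarith

lemma hasDerivWithinAt_radial_comp (hB : B.Admissible)
    {u : State → Input} {x : ℝ → State} {T : EReal} (hx : IsSolution u x T) {t : ℝ}
    (ht : t ∈ timeDomain T) (hu : ∀ᶠ s in 𝓝[≥] t, u (x s) = B.safetyControl (x s)) :
    HasDerivWithinAt (fun s => B.radial (x s))
      (-(B.kp * B.γ * |B.h (x t)| * B.radial (x t)) *
        (B.P 0 0 * (x t).2.cos ^ 2 + 2 * B.P 0 1 * ((x t).2.cos * (x t).2.sin)
          + B.P 1 1 * (x t).2.sin ^ 2) - B.kd * B.lateral (x t) ^ 2) (Ici t) t := by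
  obtain ⟨Z, -, hZx, -, hZd⟩ := hx.exists_lift (x 0).2.coe_toReal
  have hd := B.hasDerivWithinAt_radial
    (hZd t ht _ B.locallyLipschitz_safetyControl.continuous hu)
  obtain ⟨r, htr, hr⟩ := exists_gt_mem_timeDomain ht
  refine (hd.congr_of_eventuallyEq ?_ (by rw [hZx t ht])).congr_deriv ?_
  · filter_upwards [Icc_mem_nhdsGE htr] with s hs
    rw [hZx s (Icc_subset_timeDomain ht hr hs)]
  · rw [hZx t ht]
    simp only [field, B.safetyControl_eq, Matrix.cons_val_zero, Matrix.cons_val_one, hB.P_symm]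
    ring

/-- Let `w` be the component of `P e` along the heading and `q` the one across it. As long as
`-b ≤ h ≤ -η`, one has `ḣ ≥ k_p η w²` and `ẇ ≤ L |w| - k_d q²`, where `w² + q² = ‖P e‖²` is bounded
below because the annulus avoids the center. Hence `w + α t - C h` is nonincreasing for suitable
`α, C > 0`, which is impossible for all time since `w` and `h` are bounded. -/
lemma not_forall_h_mem_Icc (hB : B.Admissible) (hcenter : ∀ x ∈ B.annulus, x.1 ≠ B.center)
    {u : State → Input} (hu : ∀ x, B.h x ∈ Icc (-B.b) 0 → u x = B.safetyControl x)
    {x : ℝ → State} (hx : IsSolution u x ⊤) {η : ℝ} (hη : 0 < η)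
    (hmem : ∀ t, 0 ≤ t → B.h (x t) ∈ Icc (-B.b) (-η)) : False := by
  have ha := hB.a_pos
  have hkp := hB.kp_pos
  have hkd := hB.kd_pos
  have hann : ∀ t, 0 ≤ t → x t ∈ B.annulus := fun t ht =>
    ⟨(hmem t ht).1, by linarith [(hmem t ht).2]⟩
  obtain ⟨p, hp, hmin⟩ := (hB.isCompact_h_mem_Icc (-B.b) B.a).exists_isMinOn ⟨x 0, hann 0 le_rfl⟩
    (B.continuous_Pe.norm.pow 2).continuousOn
  set c := ‖B.Pe p‖ ^ 2
  have hc : 0 < c := pow_pos (norm_pos_iff.2 (hB.Pe_ne_zero (hcenter p hp))) 2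
  set α := B.kd * c / 2 with hα_def
  have hα : 0 < α := by positivity
  set L := B.kp * B.b * (|B.P 0 0| + 2 * |B.P 0 1| + |B.P 1 1|)
  set C := (B.kd + L ^ 2 / (4 * α)) / (B.kp * η)
  have hC : 0 < C := by positivity
  have hev : ∀ t, 0 ≤ t → ∀ᶠ s in 𝓝[≥] t, u (x s) = B.safetyControl (x s) := fun t ht => by
    filter_upwards [self_mem_nhdsWithin] with s hs
    have h := hmem s (ht.trans hs)
    exact hu _ ⟨h.1, by linarith [h.2]⟩
  have hD : ∀ t : ℝ, 0 ≤ t → t ∈ timeDomain ⊤ := fun t ht => by rwa [timeDomain_top]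
  set V : ℝ → ℝ := fun t => B.radial (x t) + α * t - C * B.h (x t)
  have hVd : ∀ t, 0 ≤ t → ∃ v ≤ 0, HasDerivWithinAt V v (Ici t) t := by
    intro t ht
    have hm := hmem t ht
    have dh := hB.hasDerivWithinAt_h_comp hx (hD t ht) (hev t ht) (by linarith [hm.2])
    have dw := hB.hasDerivWithinAt_radial_comp hx (hD t ht) (hev t ht)
    refine ⟨_, ?_, (dw.add ((hasDerivWithinAt_id t _).const_mul α)).sub (dh.const_mul C)⟩
    set w := B.radial (x t)
    set q := B.lateral (x t)
    set σ := B.P 0 0 * (x t).2.cos ^ 2 + 2 * B.P 0 1 * ((x t).2.cos * (x t).2.sin)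
          + B.P 1 1 * (x t).2.sin ^ 2
    have hcs := (x t).2.cos_sq_add_sin_sq
    have hσ : |σ| ≤ |B.P 0 0| + 2 * |B.P 0 1| + |B.P 1 1| := by
      have h1 : |B.P 0 0 * (x t).2.cos ^ 2| ≤ |B.P 0 0| := by
        rw [abs_mul]
        refine mul_le_of_le_one_right (abs_nonneg _) (abs_le.2 ⟨?_, ?_⟩) <;> nlinarith
      have h2 : |2 * B.P 0 1 * ((x t).2.cos * (x t).2.sin)| ≤ 2 * |B.P 0 1| := by
        rw [abs_mul, abs_mul, abs_two]
        refine mul_le_of_le_one_right (by positivity) (abs_le.2 ⟨?_, ?_⟩)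
        · nlinarith [sq_nonneg ((x t).2.cos + (x t).2.sin)]
        · nlinarith [sq_nonneg ((x t).2.cos - (x t).2.sin)]
      have h3 : |B.P 1 1 * (x t).2.sin ^ 2| ≤ |B.P 1 1| := by
        rw [abs_mul]
        refine mul_le_of_le_one_right (abs_nonneg _) (abs_le.2 ⟨?_, ?_⟩) <;> nlinarith
      exact (abs_add_three _ _ _).trans (by linarith)
    have hγ : |B.γ| = 1 := by rcases hB.γ_eq with h | h <;> simp [h]
    have hh : |B.h (x t)| ≤ B.b := abs_le.2 ⟨hm.1, by linarith [hm.2, hB.b_pos]⟩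
    have hlin : -(B.kp * B.γ * |B.h (x t)| * w) * σ ≤ L * |w| := by
      refine (le_abs_self _).trans ?_
      rw [abs_mul, abs_neg, abs_mul, abs_mul, abs_mul, abs_abs, hγ, abs_of_pos hkp, mul_one]
      have := mul_le_mul (mul_le_mul_of_nonneg_left hh hkp.le) hσ (abs_nonneg _)
        (mul_nonneg hkp.le hB.b_pos.le)
      calc B.kp * |B.h (x t)| * |w| * |σ| = B.kp * |B.h (x t)| * |σ| * |w| := by ring
        _ ≤ L * |w| := mul_le_mul_of_nonneg_right this (abs_nonneg _)
    -- Young's inequality, with half of the dissipation `k_d c = 2 α` to spare.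
    have hyoung : L * |w| ≤ α + L ^ 2 / (4 * α) * w ^ 2 := by
      have h1 : L ^ 2 / (4 * α) * w ^ 2 + α - L * |w| = (L * |w| - 2 * α) ^ 2 / (4 * α) := by
        rw [← sq_abs w]
        field_simp
        ring
      have h2 : 0 ≤ (L * |w| - 2 * α) ^ 2 / (4 * α) := by positivity
      linarith
    have hq : c ≤ w ^ 2 + q ^ 2 := by
      rw [B.radial_sq_add_lateral_sq]
      exact hmin (hann t ht)
    have hkq : 2 * α ≤ B.kd * w ^ 2 + B.kd * q ^ 2 := by
      have := mul_le_mul_of_nonneg_left hq hkd.le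
      rw [hα_def]
      linarith
    have hCh : (B.kd + L ^ 2 / (4 * α)) * w ^ 2 ≤ C * (-B.kp * B.h (x t) * w ^ 2) := by
      have h1 : C * (B.kp * η) = B.kd + L ^ 2 / (4 * α) :=
        div_mul_cancel₀ _ (mul_pos hkp hη).ne'
      rw [← h1]
      have h2 : B.kp * η * w ^ 2 ≤ -B.kp * B.h (x t) * w ^ 2 := by
        refine mul_le_mul_of_nonneg_right ?_ (sq_nonneg w)
        nlinarith [hm.2]
      calc C * (B.kp * η) * w ^ 2 = C * (B.kp * η * w ^ 2) := by ring
        _ ≤ _ := mul_le_mul_of_nonneg_left h2 hC.le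
    rw [mul_one]
    linarith
  have hVle : ∀ t, 0 ≤ t → V t ≤ V 0 := by
    intro t ht
    choose! v hv0 hvd using hVd
    have hxc : ContinuousOn x (Icc 0 t) := hx.continuousOn.mono fun s hs => hD s hs.1
    have hVc : ContinuousOn V (Icc 0 t) :=
      ((B.locallyLipschitz_radial.continuous.comp_continuousOn hxc).add
        (continuous_const.mul continuous_id).continuousOn).sub
        (continuousOn_const.mul (B.continuous_h.comp_continuousOn hxc))
    exact image_le_of_deriv_right_le_deriv_boundary (B := fun _ => V 0) (B' := fun _ => 0)
      hVc (fun s hs => hvd s hs.1) le_rfl continuousOn_const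
      (fun _ _ => hasDerivWithinAt_const _ _ _) (fun s hs => hv0 s hs.1) (right_mem_Icc.2 ht)
  have hrad : ∀ t, 0 ≤ t → -B.η ≤ B.radial (x t) := fun t ht =>
    (abs_le.1 ((B.abs_radial_le _).trans (hB.norm_Pe_le_η (hann t ht)))).1
  have hneg : ∀ t, 0 ≤ t → 0 ≤ -(C * B.h (x t)) := fun t ht => by
    have := mul_nonneg hC.le (show 0 ≤ -B.h (x t) by linarith [(hmem t ht).2])
    linarith
  have hV0 : 0 ≤ V 0 + B.η := by
    show 0 ≤ B.radial (x 0) + α * 0 - C * B.h (x 0) + B.η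
    linarith [hrad 0 le_rfl, hneg 0 le_rfl]
  set t := (V 0 + B.η + 1) / α
  have ht : 0 ≤ t := by positivity
  have hαt : α * t = V 0 + B.η + 1 := mul_div_cancel₀ _ hα.ne'
  have h1 : B.radial (x t) + α * t - C * B.h (x t) ≤ V 0 := hVle t ht
  linarith [hrad t ht, hneg t ht]

end Barrier.Admissible

variable {N : ℕ} {B : Fin N → Barrier} {unom : State → Input}

/-- A solution that stays in the compact set `-b < h x₀ ≤ h ≤ -η` is driven by the safety
controller only, which is locally Lipschitz. So it can be continued past a finite end time, and
for all time it cannot stay there. -/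
lemma IsMaximalSolution.exists_lt_h (hB : ∀ i, (B i).Admissible)
    (hdisj : ∀ i j, i ≠ j → (B i).annulus ∩ (B j).annulus = ∅) {i : Fin N}
    (hcenter : ∀ x ∈ (B i).annulus, x.1 ≠ (B i).center) {x : ℝ → State} {T : EReal}
    (hx : IsMaximalSolution (mixedControl B unom) x T) (hb : -(B i).b < (B i).h (x 0)) {η : ℝ}
    (hη : 0 < η) : ∃ t ∈ timeDomain T, -η < (B i).h (x t) := by
  by_contra! hle
  have hD0 := zero_mem_timeDomain hx.1.pos
  have hneg : (B i).h (x 0) ≤ 0 := by linarith [hle 0 hD0]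
  have hge : ∀ t ∈ timeDomain T, (B i).h (x 0) ≤ (B i).h (x t) := fun t ht => by
    have := min_h_zero_le hB hdisj hx.1 (i := i) hD0 ht ht.1 hb
    rwa [min_eq_left hneg] at this
  have hctrl : ∀ z, (B i).h z ∈ Icc (-(B i).b) 0 →
      mixedControl B unom z = (B i).safetyControl z := fun z hz =>
    mixedControl_of_h_nonpos hB hdisj hz
  have hxK : ∀ t ∈ timeDomain T, (B i).h (x t) ∈ Icc (-(B i).b) 0 := fun t ht =>
    ⟨hb.le.trans (hge t ht), by linarith [hle t ht]⟩
  induction T with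
  | bot => exact absurd hx.1.pos (by simp)
  | top =>
    refine (hB i).not_forall_h_mem_Icc hcenter hctrl hx.1 hη fun t ht => ?_
    have ht' : t ∈ timeDomain ⊤ := by rwa [timeDomain_top]
    exact ⟨(hxK t ht').1, hle t ht'⟩
  | coe τ =>
    have hτ : 0 < τ := by exact_mod_cast hx.1.pos
    obtain ⟨y, hyc, hy0, hysol, hyuniq⟩ := exists_flow (B i).locallyLipschitz_safetyControl
      ((hB i).isCompact_h_mem_Icc (-(B i).b) 0) (x 0)
    have hxy : EqOn x y (timeDomain τ) :=
      hyuniq x τ (hx.1.congr fun t ht => hctrl _ (hxK t ht)) rfl hxK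
    have hhy : Continuous fun t => (B i).h (y t) := (B i).continuous_h.comp hyc
    have hyτ : (B i).h (y τ) ∈ Icc ((B i).h (x 0)) (-η) := by
      refine isClosed_Icc.mem_of_tendsto ((hhy.tendsto τ).mono_left nhdsWithin_le_nhds)
        (b := 𝓝[<] τ) ?_
      filter_upwards [Ioo_mem_nhdsLT hτ] with t ht
      have ht' : t ∈ timeDomain τ := mem_timeDomain_coe.2 ⟨ht.1.le, ht.2⟩
      rw [← hxy ht']
      exact ⟨hge t ht', hle t ht'⟩
    have hnhds : {t | (B i).h (y t) ∈ Ioo (-(B i).b) 0} ∈ 𝓝 τ :=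
      (isOpen_Ioo.preimage hhy).mem_nhds ⟨hb.trans_le hyτ.1, by linarith [hyτ.2]⟩
    obtain ⟨ε, hε, hball⟩ := Metric.mem_nhds_iff.1 hnhds
    have hyK : ∀ t ∈ timeDomain ((τ + ε : ℝ) : EReal), (B i).h (y t) ∈ Icc (-(B i).b) 0 := by
      intro t ht
      rw [mem_timeDomain_coe] at ht
      rcases lt_or_ge t τ with h | h
      · have ht' : t ∈ timeDomain τ := mem_timeDomain_coe.2 ⟨ht.1, h⟩
        rw [← hxy ht']
        exact hxK t ht'
      · refine Ioo_subset_Icc_self (hball ?_)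
        rw [mem_ball, Real.dist_eq, abs_of_nonneg (by linarith)]
        linarith
    have hysol' := hysol ((τ + ε : ℝ) : EReal) (by exact_mod_cast (by linarith : 0 < τ + ε)) hyK
    refine hx.2 y _ (hysol'.congr fun t ht => (hctrl _ (hyK t ht)).symm) hxy ?_
    exact_mod_cast (by linarith : τ < τ + ε)

theorem isAsymptoticallyStable_safeSet (hB : ∀ i, (B i).Admissible)
    (hdisj : ∀ i j, i ≠ j → (B i).annulus ∩ (B j).annulus = ∅) (i : Fin N)
    (hcenter : ∀ x ∈ (B i).annulus, x.1 ≠ (B i).center) :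
    IsAsymptoticallyStable (mixedControl B unom) (B i).safeSet := by
  -- Once `h > -η` it stays so, and this keeps the state close to the safe set.
  have hstay : ∀ η > 0, η ≤ (B i).b → ∀ (x : ℝ → State) (T : EReal),
      IsSolution (mixedControl B unom) x T → ∀ t₀ ∈ timeDomain T, -η < (B i).h (x t₀) →
      ∀ t ∈ timeDomain T, t₀ ≤ t → -η < (B i).h (x t) := fun η hη hηb x T hx t₀ ht₀ h t ht htt =>
    (lt_min h (by linarith)).trans_le
      (min_h_zero_le hB hdisj hx ht₀ ht htt (by linarith))
  constructor
  · intro ε hε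
    obtain ⟨η, hη, hηb, hnear⟩ := (hB i).exists_infDist_lt_of_lt_h hε
    obtain ⟨δ, hδ, hδη⟩ := (hB i).exists_lt_h_of_infDist_lt hη
    exact ⟨δ, hδ, fun x T hx hx0 t ht => hnear _
      (hstay η hη hηb x T hx 0 (zero_mem_timeDomain hx.pos) (hδη _ hx0) t ht ht.1)⟩
  · obtain ⟨δ, hδ, hδb⟩ := (hB i).exists_lt_h_of_infDist_lt (hB i).b_pos
    refine ⟨δ, hδ, fun x T hx hx0 ε hε => ?_⟩
    obtain ⟨η, hη, hηb, hnear⟩ := (hB i).exists_infDist_lt_of_lt_h hε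
    obtain ⟨t₀, ht₀, hlt⟩ := hx.exists_lt_h hB hdisj hcenter (hδb _ hx0) hη
    exact ⟨t₀, ht₀, fun t ht htt => hnear _ (hstay η hη hηb x T hx.1 t₀ ht₀ hlt t ht htt)⟩

end Unicycle

end Stability

/-! ### The closed loop -/

theorem proposition1 {N : ℕ} (B : Fin N → Unicycle.Barrier)
    (hB : ∀ i, (B i).Admissible)
    (hdisj : ∀ i j, i ≠ j → (B i).annulus ∩ (B j).annulus = ∅)
    (U : Set Unicycle.Input)
    (unom : Unicycle.State → Unicycle.Input)
    (hnomU : ∀ x, unom x ∈ U)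
    (hnom : LocallyLipschitz unom) :
    -- (i) safety
    (∀ i, Unicycle.IsSafe (Unicycle.mixedControl B unom) (B i).safeSet) ∧
    -- (ii) boundedness in case a), and asymptotic stability in the cases a) and b)
    ((∀ i, ∀ x ∈ (B i).annulus, x.1 ≠ (B i).center) →
      ((∃ i, (B i).γ = 1) →
        Unicycle.GlobalBoundedFrom (Unicycle.mixedControl B unom)
          (Unicycle.operatingRegion B)) ∧
      (((∃ i, (B i).γ = 1) ∨
          Unicycle.GlobalBoundedFrom (Unicycle.mixedControl B unom)
            (Unicycle.operatingRegion B)) →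
        ∀ i, Unicycle.IsAsymptoticallyStable (Unicycle.mixedControl B unom)
          (B i).safeSet)) ∧
    -- (iii) input constraints
    (∀ up ud : ℝ, 0 < up → 0 < ud → U = Unicycle.inputBox up ud →
      (∀ i, (B i).kp ≤ up / ((B i).η * max (B i).a (B i).b) ∧ (B i).kd ≤ ud / (B i).η) →
        ∀ x, (∀ i, x ∈ (B i).annulus ∪ (B i).safeSet) →
          Unicycle.mixedControl B unom x ∈ U) := by
  refine ⟨fun i => Unicycle.isSafe_safeSet hB hdisj i, fun hcenter =>
    ⟨Unicycle.globalBoundedFrom_operatingRegion hB hdisj hnom, fun _ i =>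
      Unicycle.isAsymptoticallyStable_safeSet hB hdisj i (hcenter i)⟩, ?_⟩
  rintro up ud - - rfl hk x -
  exact Unicycle.mixedControl_mem_inputBox hB hdisj hnomU hk x
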